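/- Let $u, K : \mathbb{R}^2 \to \mathbb{R}$ be smooth ($C^\infty$) functions satisfying $$-\Delta u = K e^{2u} \quad \text{on } \mathbb{R}^2,$$ with $Ke^{2u} \in L^1(\mathbb{R}^2)$ and $e^{2u} \in L^1(\mathbb{R}^2)$. Suppose that $x\cdot\nabla K(x) \ge 0$ for every $x \in \mathbb{R}^2$ and that $K$ is non-negative near infinity, i.e. there is $R \in \mathbb{R}$ such that $K(x) \ge 0$ whenever $|x| \ge R$. Then $$\int_{\mathbb{R}^2} K e^{2u}\,\mathrm{d}x \ge 4\pi,$$ and equality holds if and only if $K$ is a positive constant. -/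

import Mathlib

open MeasureTheory
open scoped ContDiff Laplacian Gradient

/-!
Write `Λ = ∫ K e^{2u} = -∫ Δ u`. Testing the equation with the dilation field `x`, cut off at
scale `R`, gives Pohozaev's identity `∫ ⟪x, ∇ K⟫ e^{2u} + 2 Λ = 2 lim ∫ Δ u ⟪x, ∇ u⟫`.

By convexity of the exponential, finiteness of `∫ e^{2u}` bounds the averages of `u` on the disc of
radius `r` by `-log r + O(1)`. As the flux of `∇ u` makes these averages fall no faster than
`Λ / (2π) * log r`, this forces `0 < Λ`. Moreover the averages of `|u|` are `O(log r)`, so `∇ u` has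
no harmonic part: it is the convolution of `Δ u` with `y / (2π ‖y‖²)`. Symmetrizing
`∫ Δ u ⟪x, ∇ u⟫` in the two variables then replaces the kernel `⟪x - z, x⟫ / ‖x - z‖²` by `1 / 2`,
and the limit is `Λ² / (4π)`.

Hence `∫ ⟪x, ∇ K⟫ e^{2u} = Λ (Λ - 4π) / (2π)`. The left side is nonnegative, so `4π ≤ Λ`, and it
vanishes exactly when `K` is constant along rays from the origin.
-/

section VectorCalculus

variable {E : Type*} [NormedAddCommGroup E] [InnerProductSpace ℝ E]

/-- The divergence of a vector field, encoded as the trace of its Fréchet derivative; in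
coordinates this is the usual `∑ i, ∂ᵢ Xᵢ`. -/
noncomputable def divergence (X : E → E) (x : E) : ℝ :=
  LinearMap.trace ℝ E (fderiv ℝ X x)

theorem divergence_smul [FiniteDimensional ℝ E] {f : E → ℝ} {X : E → E} {x : E}
    (hf : DifferentiableAt ℝ f x) (hX : DifferentiableAt ℝ X x) :
    divergence (fun y => f y • X y) x = f x * divergence X x + fderiv ℝ f x (X x) := by
  simp only [divergence, fderiv_fun_smul hf hX, ContinuousLinearMap.toLinearMap_add,
    ContinuousLinearMap.toLinearMap_smul, map_add, map_smul, smul_eq_mul,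
    ContinuousLinearMap.coe_smulRight]
  rw [LinearMap.trace_smulRight]
  rfl

theorem hasCompactSupport_of_fderiv_apply {f : E → ℝ} {X : E → E}
    (hc : HasCompactSupport f ∨ HasCompactSupport X) :
    HasCompactSupport fun x => fderiv ℝ f x (X x) := by
  rcases hc with hf | hX
  · refine (hf.fderiv (𝕜 := ℝ)).mono fun x hx hfx => hx ?_
    simp [hfx]
  · refine hX.mono fun x hx hXx => hx ?_
    simp [hXx]

theorem hasCompactSupport_divergence {X : E → E} (hc : HasCompactSupport X) :
    HasCompactSupport (divergence X) := by
  refine (hc.fderiv (𝕜 := ℝ)).mono fun x hx hXx => hx ?_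
  simp [divergence, hXx]

theorem contDiff_gradient [CompleteSpace E] {w : E → ℝ} {m n : ℕ∞ω} (hw : ContDiff ℝ n w)
    (hmn : m + 1 ≤ n) : ContDiff ℝ m (∇ w) :=
  (InnerProductSpace.toDual ℝ E).symm.contDiff.comp (hw.fderiv_right hmn)

theorem inner_fderiv_gradient [CompleteSpace E] {w : E → ℝ} (hw : ContDiff ℝ 2 w) (x a v : E) :
    inner ℝ a (fderiv ℝ (∇ w) x v) = fderiv ℝ (fderiv ℝ w) x v a := by
  have hgrad := (contDiff_gradient hw (m := 1) (by norm_num)).differentiable one_ne_zero x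
  have hfderiv := (hw.fderiv_right (m := 1) (by norm_num)).differentiable one_ne_zero x
  have hpairing : (fun y => inner ℝ a (∇ w y)) = fun y => fderiv ℝ w y a :=
    funext fun y => inner_gradient_right
  have hderiv := congrArg (fun f => fderiv ℝ f x v) hpairing
  rw [fderiv_inner_apply ℝ (differentiableAt_const a) hgrad,
    fderiv_clm_apply hfderiv (differentiableAt_const a)] at hderiv
  simpa using hderiv

variable [FiniteDimensional ℝ E]

theorem continuous_divergence {X : E → E} (hX : ContDiff ℝ 1 X) : Continuous (divergence X) := by
  have htrace : Continuous ((LinearMap.trace ℝ E) ∘ₗ ContinuousLinearMap.coeLM ℝ) :=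
    LinearMap.continuous_of_finiteDimensional _
  exact htrace.comp (hX.continuous_fderiv one_ne_zero)

theorem laplacian_eq_divergence_gradient {w : E → ℝ} (hw : ContDiff ℝ 2 w) (x : E) :
    Δ w x = divergence (∇ w) x := by
  rw [InnerProductSpace.laplacian_eq_iteratedFDeriv_orthonormalBasis w (stdOrthonormalBasis ℝ E),
    divergence, LinearMap.trace_eq_sum_inner _ (stdOrthonormalBasis ℝ E)]
  refine Finset.sum_congr rfl fun i _ => ?_
  rw [iteratedFDeriv_two_apply]
  exact (inner_fderiv_gradient hw x _ _).symm

theorem continuous_laplacian {w : E → ℝ} (hw : ContDiff ℝ 2 w) : Continuous (Δ w) := by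
  rw [funext (laplacian_eq_divergence_gradient hw)]
  exact continuous_divergence (contDiff_gradient hw (by norm_num))

variable [MeasurableSpace E] [BorelSpace E] (μ : Measure E) [μ.IsAddHaarMeasure]

theorem integral_fderiv_apply_eq_zero {g : E → ℝ} (hg : ContDiff ℝ 1 g) (hc : HasCompactSupport g)
    (v : E) : ∫ x, fderiv ℝ g x v ∂μ = 0 := by
  have hfderiv : Integrable (fun x => fderiv ℝ g x v) μ :=
    ((hg.continuous_fderiv one_ne_zero).clm_apply continuous_const).integrable_of_hasCompactSupport
      (hasCompactSupport_of_fderiv_apply (.inl hc))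
  have hparts := integral_mul_fderiv_eq_neg_fderiv_mul_of_integrable (μ := μ)
    (f := fun _ : E => (1 : ℝ)) (g := g) (v := v) (by simp) (by simpa using hfderiv)
    (by simpa using hg.continuous.integrable_of_hasCompactSupport hc)
    (fun _ _ => differentiableAt_const _) (fun x _ => hg.differentiable one_ne_zero x)
  simpa using hparts

theorem integral_divergence_eq_zero {X : E → E} (hX : ContDiff ℝ 1 X) (hc : HasCompactSupport X) :
    ∫ x, divergence X x ∂μ = 0 := by
  let b := stdOrthonormalBasis ℝ E
  have hdiv (x : E) : divergence X x = ∑ i, fderiv ℝ (fun y => inner ℝ (b i) (X y)) x (b i) := by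
    rw [divergence, LinearMap.trace_eq_sum_inner _ b]
    refine Finset.sum_congr rfl fun i _ => ?_
    rw [fderiv_inner_apply ℝ (differentiableAt_const _) (hX.differentiable one_ne_zero x)]
    simp
  have hcoord (i) : ContDiff ℝ 1 fun y => inner ℝ (b i) (X y) := contDiff_const.inner ℝ hX
  have hcoord_supp (i) : HasCompactSupport fun y => inner ℝ (b i) (X y) :=
    hc.mono fun x hx hXx => hx (by simp [hXx])
  have hcoord_int (i) :
      Integrable (fun x => fderiv ℝ (fun y => inner ℝ (b i) (X y)) x (b i)) μ :=
    (((hcoord i).continuous_fderiv one_ne_zero).clm_apply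
      continuous_const).integrable_of_hasCompactSupport
        (hasCompactSupport_of_fderiv_apply (.inl (hcoord_supp i)))
  simp only [hdiv]
  rw [integral_finsetSum _ fun i _ => hcoord_int i]
  exact Finset.sum_eq_zero fun i _ => integral_fderiv_apply_eq_zero μ (hcoord i) (hcoord_supp i) _

theorem integral_mul_divergence {f : E → ℝ} {X : E → E} (hf : ContDiff ℝ 1 f)
    (hX : ContDiff ℝ 1 X) (hc : HasCompactSupport f ∨ HasCompactSupport X) :
    ∫ x, f x * divergence X x ∂μ = -∫ x, fderiv ℝ f x (X x) ∂μ := by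
  have hfX : HasCompactSupport fun x => f x • X x :=
    hc.elim (fun h => h.smul_right) (fun h => h.smul_left)
  have hmul_supp : HasCompactSupport fun x => f x * divergence X x :=
    hc.elim (fun h => h.mul_right) (fun h => (hasCompactSupport_divergence h).mul_left)
  have hmul_int : Integrable (fun x => f x * divergence X x) μ :=
    (hf.continuous.mul (continuous_divergence hX)).integrable_of_hasCompactSupport hmul_supp
  have hprod (x : E) : divergence (fun y => f y • X y) x
      = f x * divergence X x + fderiv ℝ f x (X x) :=
    divergence_smul (hf.differentiable one_ne_zero x) (hX.differentiable one_ne_zero x)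
  have hzero : ∫ x, divergence (fun y => f y • X y) x ∂μ = 0 :=
    integral_divergence_eq_zero μ (hf.smul hX) hfX
  rw [integral_congr_ae (.of_forall hprod), integral_add hmul_int
    (((hf.continuous_fderiv one_ne_zero).clm_apply hX.continuous).integrable_of_hasCompactSupport
      (hasCompactSupport_of_fderiv_apply hc))] at hzero
  linarith

theorem integral_mul_laplacian {f w : E → ℝ} (hf : ContDiff ℝ 1 f) (hc : HasCompactSupport f)
    (hw : ContDiff ℝ 2 w) :
    ∫ x, f x * Δ w x ∂μ = -∫ x, fderiv ℝ f x (∇ w x) ∂μ := by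
  simp only [laplacian_eq_divergence_gradient hw]
  exact integral_mul_divergence μ hf (contDiff_gradient hw (by norm_num)) (.inl hc)

theorem integral_inner_mul_laplacian {X : E → E} (hX : ContDiff ℝ 1 X) (hc : HasCompactSupport X)
    (hsymm : ∀ x a b, inner ℝ (fderiv ℝ X x a) b = inner ℝ a (fderiv ℝ X x b)) {w : E → ℝ}
    (hw : ContDiff ℝ 2 w) (v : E) :
    ∫ x, inner ℝ (X x) v * Δ w x ∂μ = -∫ x, divergence X x * fderiv ℝ w x v ∂μ := by
  have hdw : ContDiff ℝ 1 (fderiv ℝ w) := hw.fderiv_right (by norm_num)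
  have hdwv : ContDiff ℝ 1 fun y => fderiv ℝ w y v := hdw.clm_apply contDiff_const
  have hdX (x : E) : DifferentiableAt ℝ X x := hX.differentiable one_ne_zero x
  have hddw (x : E) : DifferentiableAt ℝ (fderiv ℝ w) x := hdw.differentiable one_ne_zero x
  have hinner (x a : E) : fderiv ℝ (fun y => inner ℝ (X y) v) x a
      = inner ℝ a (fderiv ℝ X x v) := by
    rw [fderiv_inner_apply ℝ (hdX x) (differentiableAt_const v), ← hsymm]
    simp
  have hderiv_field (x : E) : fderiv ℝ (fun y => fderiv ℝ w y (X y)) x v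
      = fderiv ℝ w x (fderiv ℝ X x v) + fderiv ℝ (fun y => fderiv ℝ w y v) x (X x) := by
    have hsnd : IsSymmSndFDerivAt ℝ w x := hw.contDiffAt.isSymmSndFDerivAt (by simp)
    rw [fderiv_clm_apply (hddw x) (hdX x),
      fderiv_clm_apply (hddw x) (differentiableAt_const v)]
    simp [hsnd.eq (X x) v]
  have hzero := integral_fderiv_apply_eq_zero μ (hdw.clm_apply hX)
    (hasCompactSupport_of_fderiv_apply (f := w) (.inr hc)) v
  rw [integral_congr_ae (.of_forall hderiv_field), integral_add] at hzero
  · calc ∫ x, inner ℝ (X x) v * Δ w x ∂μ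
        = -∫ x, fderiv ℝ w x (fderiv ℝ X x v) ∂μ := by
          rw [integral_mul_laplacian μ (hX.inner ℝ contDiff_const)
            (hc.mono fun x hx hXx => hx (by simp [hXx])) hw]
          simp only [hinner, inner_gradient_left]
      _ = ∫ x, fderiv ℝ (fun y => fderiv ℝ w y v) x (X x) ∂μ := by linarith
      _ = -∫ x, divergence X x * fderiv ℝ w x v ∂μ := by
          simp only [mul_comm (divergence X _)]
          rw [integral_mul_divergence μ hdwv hX (.inr hc), neg_neg]
  · exact (hdw.continuous.clm_apply
      ((hX.continuous_fderiv one_ne_zero).clm_apply continuous_const))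
      |>.integrable_of_hasCompactSupport
        ((hc.fderiv (𝕜 := ℝ)).mono fun x hx hXx => hx (by simp [hXx]))
  · exact ((hdwv.continuous_fderiv one_ne_zero).clm_apply hX.continuous)
      |>.integrable_of_hasCompactSupport (hasCompactSupport_of_fderiv_apply (.inr hc))

end VectorCalculus

section Radial

theorem hasCompactSupport_comp_norm_sq {E : Type*} [NormedAddCommGroup E] [ProperSpace E]
    {q : ℝ → ℝ} {S : ℝ} (hq : ∀ s, S ≤ s → q s = 0) :
    HasCompactSupport fun y : E => q (‖y‖ ^ 2) := by
  refine HasCompactSupport.intro (isCompact_closedBall 0 (|S| + 1)) fun x hx => hq _ ?_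
  simp only [Metric.mem_closedBall, dist_zero_right, not_le] at hx
  nlinarith [le_abs_self S, abs_nonneg S]

variable {E : Type*} [NormedAddCommGroup E] [InnerProductSpace ℝ E]

theorem differentiable_comp_norm_sq {q : ℝ → ℝ} (hq : Differentiable ℝ q) :
    Differentiable ℝ fun y : E => q (‖y‖ ^ 2) :=
  hq.comp (differentiable_id.norm_sq ℝ)

theorem fderiv_comp_norm_sq {q : ℝ → ℝ} (hq : Differentiable ℝ q) (y v : E) :
    fderiv ℝ (fun y => q (‖y‖ ^ 2)) y v = 2 * deriv q (‖y‖ ^ 2) * inner ℝ y v := by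
  have hcomp := ((hq (‖y‖ ^ 2)).hasDerivAt.comp_hasFDerivAt y
    (hasStrictFDerivAt_norm_sq y).hasFDerivAt).fderiv
  rw [Function.comp_def] at hcomp
  rw [hcomp]
  simp only [smul_apply, coe_innerSL_apply, smul_eq_mul, nsmul_eq_mul]
  ring

theorem fderiv_radial_smul {q : ℝ → ℝ} (hq : Differentiable ℝ q) (y v : E) :
    fderiv ℝ (fun y => q (‖y‖ ^ 2) • y) y v
      = q (‖y‖ ^ 2) • v + (2 * deriv q (‖y‖ ^ 2) * inner ℝ y v) • y := by
  rw [fderiv_fun_smul (f := fun y => y)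
    (differentiable_comp_norm_sq hq y) differentiableAt_fun_id]
  simp [fderiv_comp_norm_sq hq]

theorem inner_fderiv_radial_smul_comm {q : ℝ → ℝ} (hq : Differentiable ℝ q) (y a b : E) :
    inner ℝ (fderiv ℝ (fun y => q (‖y‖ ^ 2) • y) y a) b
      = inner ℝ a (fderiv ℝ (fun y => q (‖y‖ ^ 2) • y) y b) := by
  simp only [fderiv_radial_smul hq, inner_add_left, inner_add_right, real_inner_smul_left,
    real_inner_smul_right, real_inner_comm y a]
  ring

theorem divergence_radial_smul [FiniteDimensional ℝ E] {q : ℝ → ℝ} (hq : Differentiable ℝ q)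
    (y : E) : divergence (fun y : E => q (‖y‖ ^ 2) • y) y
      = Module.finrank ℝ E * q (‖y‖ ^ 2) + 2 * ‖y‖ ^ 2 * deriv q (‖y‖ ^ 2) := by
  rw [divergence_smul (X := fun y => y)
    (differentiable_comp_norm_sq hq y) differentiableAt_fun_id,
    fderiv_comp_norm_sq hq, real_inner_self_eq_norm_sq]
  simp only [divergence, fderiv_fun_id, ContinuousLinearMap.coe_id, LinearMap.trace_id]
  ring

end Radial

section Cutoff

open Filter Topology

/-- The smooth profile `η` of all radial cut-offs: it decreases from `1` on `(-∞, 1]` to `0` on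
`[2, ∞)`. -/
noncomputable def cutoffProfile (s : ℝ) : ℝ := Real.smoothTransition (2 - s)

theorem contDiff_cutoffProfile {n : ℕ∞} : ContDiff ℝ n cutoffProfile :=
  Real.smoothTransition.contDiff.comp (contDiff_const.sub contDiff_id)

theorem continuous_cutoffProfile : Continuous cutoffProfile :=
  (contDiff_cutoffProfile (n := 0)).continuous

theorem differentiable_cutoffProfile : Differentiable ℝ cutoffProfile :=
  (contDiff_cutoffProfile (n := 1)).differentiable one_ne_zero

theorem contDiff_deriv_cutoffProfile : ContDiff ℝ 1 (deriv cutoffProfile) :=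
  ((contDiff_succ_iff_deriv (n := 1)).1 (contDiff_cutoffProfile (n := 2))).2.2

theorem cutoffProfile_of_le_one {s : ℝ} (hs : s ≤ 1) : cutoffProfile s = 1 :=
  Real.smoothTransition.one_of_one_le (by linarith)

theorem cutoffProfile_of_two_le {s : ℝ} (hs : 2 ≤ s) : cutoffProfile s = 0 :=
  Real.smoothTransition.zero_of_nonpos (by linarith)

theorem cutoffProfile_nonneg (s : ℝ) : 0 ≤ cutoffProfile s := Real.smoothTransition.nonneg _

theorem cutoffProfile_le_one (s : ℝ) : cutoffProfile s ≤ 1 := Real.smoothTransition.le_one _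

theorem deriv_cutoffProfile_of_two_le {s : ℝ} (hs : 2 ≤ s) : deriv cutoffProfile s = 0 := by
  have hconst : Set.EqOn cutoffProfile (fun _ => 0) (Set.Ici 2) :=
    fun t ht => cutoffProfile_of_two_le ht
  have hderiv := derivWithin_congr hconst (cutoffProfile_of_two_le hs)
  rwa [(differentiable_cutoffProfile s).derivWithin (uniqueDiffOn_Ici 2 s hs),
    derivWithin_fun_const, Pi.zero_apply] at hderiv

/-- The cut-off at scale `r` of a normed space, equal to `1` on the ball of radius `r` and to `0`
outside the ball of radius `√2 * r`. -/
noncomputable def cutoff {E : Type*} [NormedAddCommGroup E] (r : ℝ) (x : E) : ℝ :=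
  cutoffProfile (‖x‖ ^ 2 / r ^ 2)

section NormedSpace

variable {E : Type*} [NormedAddCommGroup E]

theorem continuous_cutoff (r : ℝ) : Continuous (cutoff r : E → ℝ) :=
  continuous_cutoffProfile.comp (by fun_prop)

theorem cutoff_nonneg (r : ℝ) (x : E) : 0 ≤ cutoff r x := cutoffProfile_nonneg _

theorem cutoff_le_one (r : ℝ) (x : E) : cutoff r x ≤ 1 := cutoffProfile_le_one _

theorem cutoff_eq_one_of_norm_le {r : ℝ} {x : E} (hx : ‖x‖ ≤ r) : cutoff r x = 1 :=
  cutoffProfile_of_le_one (div_le_one_of_le₀ (by gcongr) (by positivity))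

theorem cutoff_smul [NormedSpace ℝ E] {r : ℝ} (hr : r ≠ 0) (x : E) :
    cutoff r (r • x) = cutoff 1 x := by
  rw [cutoff, cutoff, norm_smul, Real.norm_eq_abs, mul_pow, sq_abs]
  field_simp

theorem hasCompactSupport_cutoff [ProperSpace E] {r : ℝ} (hr : r ≠ 0) :
    HasCompactSupport (cutoff r : E → ℝ) :=
  hasCompactSupport_comp_norm_sq (q := fun s => cutoffProfile (s / r ^ 2)) (S := 2 * r ^ 2)
    fun _ hs => cutoffProfile_of_two_le (by rwa [le_div_iff₀ (by positivity)])

theorem contDiff_cutoff {F : Type*} [NormedAddCommGroup F] [InnerProductSpace ℝ F] {n : ℕ∞}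
    (r : ℝ) : ContDiff ℝ n (cutoff r : F → ℝ) :=
  contDiff_cutoffProfile.comp ((contDiff_norm_sq ℝ).div_const _)

theorem tendsto_integral_comp_norm_sq_div_mul [MeasurableSpace E] [OpensMeasurableSpace E]
    {μ : Measure E} {q : ℝ → ℝ} (hq : Continuous q) {C : ℝ} (hC : ∀ s, 0 ≤ s → |q s| ≤ C)
    {D : E → ℝ} (hD : Integrable D μ) :
    Tendsto (fun r : ℝ => ∫ y, q (‖y‖ ^ 2 / r ^ 2) * D y ∂μ) atTop (𝓝 (q 0 * ∫ y, D y ∂μ)) := by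
  rw [← integral_const_mul]
  refine tendsto_integral_filter_of_dominated_convergence (fun y => C * |D y|)
    (.of_forall fun r => ?_) (.of_forall fun r => .of_forall fun y => ?_) (hD.abs.const_mul C)
    (.of_forall fun y => ?_)
  · exact (hq.comp (by fun_prop)).aestronglyMeasurable.mul hD.aestronglyMeasurable
  · rw [norm_mul, Real.norm_eq_abs, Real.norm_eq_abs]
    exact mul_le_mul_of_nonneg_right (hC _ (by positivity)) (abs_nonneg _)
  · have hscale : Tendsto (fun r : ℝ => ‖y‖ ^ 2 / r ^ 2) atTop (𝓝 0) :=
      tendsto_const_nhds.div_atTop (tendsto_pow_atTop two_ne_zero)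
    exact ((hq.tendsto 0).comp hscale).mul_const _

theorem tendsto_integral_cutoff_mul [MeasurableSpace E] [OpensMeasurableSpace E]
    {μ : Measure E} {D : E → ℝ} (hD : Integrable D μ) :
    Tendsto (fun r : ℝ => ∫ y, cutoff r y * D y ∂μ) atTop (𝓝 (∫ y, D y ∂μ)) := by
  have hbound (s : ℝ) (_ : 0 ≤ s) : |cutoffProfile s| ≤ 1 := by
    rw [abs_of_nonneg (cutoffProfile_nonneg s)]
    exact cutoffProfile_le_one s
  simpa [cutoffProfile_of_le_one zero_le_one, cutoff] using
    tendsto_integral_comp_norm_sq_div_mul continuous_cutoffProfile hbound hD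

end NormedSpace

end Cutoff

section DerivativeUnderDilation

variable {E : Type*} [NormedAddCommGroup E] [NormedSpace ℝ E] [MeasurableSpace E] [BorelSpace E]

theorem hasDerivAt_integral_mul_comp_smul {μ : Measure E} [IsFiniteMeasureOnCompacts μ]
    {W u : E → ℝ} (hW : Continuous W) (hWc : HasCompactSupport W) (hu : ContDiff ℝ 1 u) (r : ℝ) :
    HasDerivAt (fun t => ∫ y, W y * u (t • y) ∂μ) (∫ y, W y * fderiv ℝ u (r • y) y ∂μ) r := by
  have hu0 := hu.continuous
  have hdu := hu.continuous_fderiv one_ne_zero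
  have hderiv_cont : Continuous fun z : ℝ × E => fderiv ℝ u (z.1 • z.2) z.2 :=
    (hdu.comp (by fun_prop)).clm_apply continuous_snd
  obtain ⟨C, hC⟩ := ((isCompact_Icc (a := r - 1) (b := r + 1)).prod hWc)
    |>.exists_bound_of_continuousOn hderiv_cont.continuousOn
  refine (hasDerivAt_integral_of_dominated_loc_of_deriv_le
    (F := fun t y => W y * u (t • y)) (F' := fun t y => W y * fderiv ℝ u (t • y) y)
    (bound := fun y => ‖W y‖ * C) (Metric.ball_mem_nhds r one_pos)
    (.of_forall fun t => ?_) ?_ ?_ (.of_forall fun y t ht => ?_) ?_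
    (.of_forall fun y t _ => ?_)).2
  · have hint : Integrable (fun y => W y * u (t • y)) μ :=
      (hW.mul (hu0.comp (by fun_prop))).integrable_of_hasCompactSupport hWc.mul_right
    exact hint.aestronglyMeasurable
  · exact (hW.mul (hu0.comp (by fun_prop))).integrable_of_hasCompactSupport hWc.mul_right
  · have hint : Integrable (fun y => W y * fderiv ℝ u (r • y) y) μ :=
      (hW.mul ((hdu.comp (by fun_prop)).clm_apply continuous_id)).integrable_of_hasCompactSupport
        hWc.mul_right
    exact hint.aestronglyMeasurable
  · rw [norm_mul]
    by_cases hy : y ∈ tsupport W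
    · rw [Metric.mem_ball, Real.dist_eq, abs_lt] at ht
      exact mul_le_mul_of_nonneg_left (hC (t, y) ⟨⟨by linarith, by linarith⟩, hy⟩) (norm_nonneg _)
    · simp [image_eq_zero_of_notMem_tsupport hy]
  · exact (hW.norm.mul continuous_const).integrable_of_hasCompactSupport hWc.norm.mul_right
  · have hline : HasDerivAt (fun t : ℝ => t • y) y t := by
      simpa using (hasDerivAt_id t).smul_const y
    exact ((hu.differentiable one_ne_zero (t • y)).hasFDerivAt.comp_hasDerivAt t hline).const_mul _

end DerivativeUnderDilation

theorem sub_mul_log_le_of_le_mul_deriv {g g' : ℝ → ℝ} {a c : ℝ} (ha : 0 < a)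
    (hg : ∀ r, a ≤ r → HasDerivAt g (g' r) r) (hc : ∀ r, a ≤ r → -c ≤ r * g' r) {r : ℝ}
    (hr : a ≤ r) : g a - c * (Real.log r - Real.log a) ≤ g r := by
  have hderiv (t : ℝ) (ht : a ≤ t) :
      HasDerivAt (fun t => g t + c * Real.log t) (g' t + c * t⁻¹) t :=
    (hg t ht).add ((Real.hasDerivAt_log (ha.trans_le ht).ne').const_mul c)
  have hmono : MonotoneOn (fun t => g t + c * Real.log t) (Set.Ici a) := by
    refine monotoneOn_of_deriv_nonneg (convex_Ici a)
      (fun t ht => (hderiv t ht).continuousAt.continuousWithinAt)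
      (fun t ht => (hderiv t (interior_subset ht)).differentiableAt.differentiableWithinAt)
      fun t ht => ?_
    have hat : a ≤ t := interior_subset ht
    have htpos : 0 < t := ha.trans_le hat
    rw [(hderiv t hat).deriv, show g' t + c * t⁻¹ = (t * g' t + c) * t⁻¹ by field_simp]
    exact mul_nonneg (by linarith [hc t hat]) (inv_nonneg.2 htpos.le)
  linarith [hmono (Set.mem_Ici.2 le_rfl) (Set.mem_Ici.2 hr) hr]

section LogarithmicGrowth

open Filter Topology

/-- The Euclidean plane. -/
abbrev Plane := EuclideanSpace ℝ (Fin 2)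

theorem sq_mul_integral_comp_smul (g : Plane → ℝ) {r : ℝ} (hr : 0 < r) :
    r ^ 2 * ∫ y, g (r • y) = ∫ y, g y := by
  rw [Measure.integral_comp_smul_of_nonneg _ _ _ (hR := hr.le), finrank_euclideanSpace_fin,
    smul_eq_mul, mul_inv_cancel_left₀ (by positivity)]

/-- The function `P` with `P' = -η / 2` that vanishes on `[2, ∞)`. The gradient of
`y ↦ P (‖y‖ ^ 2)` is the cut-off dilation field `-η (‖y‖ ^ 2) • y`. -/
noncomputable def cutoffPrimitive (s : ℝ) : ℝ := (∫ t in s..2, cutoffProfile t) / 2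

theorem hasDerivAt_cutoffPrimitive (s : ℝ) :
    HasDerivAt cutoffPrimitive (-cutoffProfile s / 2) s :=
  (intervalIntegral.integral_hasDerivAt_left (continuous_cutoffProfile.intervalIntegrable _ _)
    (continuous_cutoffProfile.stronglyMeasurableAtFilter _ _)
    continuous_cutoffProfile.continuousAt).div_const 2

theorem contDiff_cutoffPrimitive : ContDiff ℝ 1 cutoffPrimitive := by
  refine contDiff_one_iff_deriv.2
    ⟨fun s => (hasDerivAt_cutoffPrimitive s).differentiableAt, ?_⟩
  rw [funext fun s => (hasDerivAt_cutoffPrimitive s).deriv]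
  exact continuous_cutoffProfile.neg.div_const 2

theorem cutoffPrimitive_of_two_le {s : ℝ} (hs : 2 ≤ s) : cutoffPrimitive s = 0 := by
  have hzero : ∫ t in s..2, cutoffProfile t = 0 := by
    rw [intervalIntegral.integral_congr (g := fun _ => (0 : ℝ)), intervalIntegral.integral_zero]
    intro t ht
    rw [Set.uIcc_of_ge hs] at ht
    exact cutoffProfile_of_two_le ht.1
  rw [cutoffPrimitive, hzero, zero_div]

theorem abs_cutoffPrimitive_le_one {s : ℝ} (hs : 0 ≤ s) : |cutoffPrimitive s| ≤ 1 := by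
  rcases le_total 2 s with h2 | h2
  · simp [cutoffPrimitive_of_two_le h2]
  have hbound : ‖∫ t in s..2, cutoffProfile t‖ ≤ 1 * |2 - s| :=
    intervalIntegral.norm_integral_le_of_norm_le_const fun t _ => by
      rw [Real.norm_of_nonneg (cutoffProfile_nonneg t)]
      exact cutoffProfile_le_one t
  rw [Real.norm_eq_abs, abs_of_nonneg (by linarith : 0 ≤ 2 - s)] at hbound
  rw [cutoffPrimitive, abs_div, abs_two]
  linarith

theorem cutoffPrimitive_zero_nonneg : 0 ≤ cutoffPrimitive 0 :=
  div_nonneg (intervalIntegral.integral_nonneg zero_le_two fun t _ => cutoffProfile_nonneg t)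
    zero_le_two

theorem integrable_cutoff_mul {r : ℝ} (hr : r ≠ 0) {g : Plane → ℝ} (hg : Continuous g) :
    Integrable fun y => cutoff r y * g y :=
  ((continuous_cutoff r).mul hg).integrable_of_hasCompactSupport
    (hasCompactSupport_cutoff hr).mul_right

/-- The integral of `u` over the disc of radius `r`, normalized to the unit disc and smoothed by
the cut-off. -/
noncomputable def discIntegral (u : Plane → ℝ) (r : ℝ) : ℝ := ∫ y, cutoff 1 y * u (r • y)

theorem hasDerivAt_discIntegral {u : Plane → ℝ} (hu : ContDiff ℝ 1 u) (r : ℝ) :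
    HasDerivAt (discIntegral u) (∫ y, cutoff 1 y * fderiv ℝ u (r • y) y) r :=
  hasDerivAt_integral_mul_comp_smul (continuous_cutoff 1) (hasCompactSupport_cutoff one_ne_zero)
    hu r

theorem mul_deriv_discIntegral {u : Plane → ℝ} (hu : ContDiff ℝ 2 u) {r : ℝ} (hr : 0 < r) :
    r * ∫ y, cutoff 1 y * fderiv ℝ u (r • y) y
      = ∫ y, cutoffPrimitive (‖y‖ ^ 2 / r ^ 2) * Δ u y := by
  have hprofile (s : ℝ) : HasDerivAt (fun s => cutoffPrimitive (s / r ^ 2))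
      (-cutoffProfile (s / r ^ 2) / 2 * (1 / r ^ 2)) s :=
    (hasDerivAt_cutoffPrimitive _).comp s ((hasDerivAt_id s).div_const _)
  have hsupport : HasCompactSupport fun y : Plane => cutoffPrimitive (‖y‖ ^ 2 / r ^ 2) :=
    hasCompactSupport_comp_norm_sq (q := fun s => cutoffPrimitive (s / r ^ 2)) (S := 2 * r ^ 2)
      fun _ hs => cutoffPrimitive_of_two_le (by rwa [le_div_iff₀ (by positivity)])
  have hgrad (y : Plane) : fderiv ℝ (fun y : Plane => cutoffPrimitive (‖y‖ ^ 2 / r ^ 2)) y (∇ u y)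
      = -(r ^ 2)⁻¹ * (cutoff r y * fderiv ℝ u y y) := by
    rw [fderiv_comp_norm_sq fun s => (hprofile s).differentiableAt, (hprofile _).deriv,
      real_inner_comm, inner_gradient_left, cutoff]
    ring
  have hsmooth : ContDiff ℝ 1 fun y : Plane => cutoffPrimitive (‖y‖ ^ 2 / r ^ 2) :=
    contDiff_cutoffPrimitive.comp ((contDiff_norm_sq ℝ).div_const _)
  rw [integral_mul_laplacian volume hsmooth hsupport hu]
  simp only [hgrad]
  rw [integral_const_mul, ← sq_mul_integral_comp_smul (fun y => cutoff r y * fderiv ℝ u y y) hr]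
  simp only [cutoff_smul hr.ne', map_smul, smul_eq_mul, mul_left_comm _ r]
  rw [integral_const_mul]
  field_simp

theorem abs_integral_cutoffPrimitive_mul_le {D : Plane → ℝ} (hD : Integrable D) (r : ℝ) :
    |∫ y, cutoffPrimitive (‖y‖ ^ 2 / r ^ 2) * D y| ≤ ∫ y, |D y| := by
  rw [← Real.norm_eq_abs]
  refine norm_integral_le_of_norm_le hD.abs (.of_forall fun y => ?_)
  rw [norm_mul, Real.norm_eq_abs, Real.norm_eq_abs]
  exact mul_le_of_le_one_left (abs_nonneg _) (abs_cutoffPrimitive_le_one (by positivity))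

theorem discIntegral_one_sub_le {u : Plane → ℝ} (hu : ContDiff ℝ 2 u) (hΔ : Integrable (Δ u))
    {r : ℝ} (hr : 1 ≤ r) :
    discIntegral u 1 - (∫ y, |Δ u y|) * Real.log r ≤ discIntegral u r := by
  have hlower := sub_mul_log_le_of_le_mul_deriv one_pos
    (fun t _ => hasDerivAt_discIntegral (hu.of_le one_le_two) t) (c := ∫ y, |Δ u y|)
    (fun t ht => by
      rw [mul_deriv_discIntegral hu (one_pos.trans_le ht)]
      exact neg_le_of_abs_le (abs_integral_cutoffPrimitive_mul_le hΔ t)) hr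
  simpa using hlower

theorem sq_mul_integral_cutoff_mul_exp_le {u : Plane → ℝ}
    (hexp : Integrable fun y => Real.exp (2 * u y)) {r : ℝ} (hr : 0 < r) :
    r ^ 2 * ∫ y, cutoff 1 y * Real.exp (2 * u (r • y)) ≤ ∫ y, Real.exp (2 * u y) := by
  rw [← sq_mul_integral_comp_smul (fun y => Real.exp (2 * u y)) hr]
  refine mul_le_mul_of_nonneg_left (integral_mono_of_nonneg (.of_forall fun y => ?_)
    (hexp.comp_smul hr.ne') (.of_forall fun y => ?_)) (by positivity)
  · exact mul_nonneg (cutoff_nonneg _ _) (Real.exp_pos _).le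
  · exact mul_le_of_le_one_left (Real.exp_pos _).le (cutoff_le_one _ _)

theorem discIntegral_le {u : Plane → ℝ} (hu : Continuous u)
    (hexp : Integrable fun y => Real.exp (2 * u y)) {r : ℝ} (hr : 0 < r) :
    2 * discIntegral u r + (2 * Real.log r + 1) * (∫ y : Plane, cutoff 1 y) ≤
      ∫ y, Real.exp (2 * u y) := by
  have hu_int : Integrable fun y => cutoff 1 y * u (r • y) :=
    integrable_cutoff_mul one_ne_zero (hu.comp (by fun_prop))
  have hcutoff_int : Integrable (cutoff 1 : Plane → ℝ) :=
    (continuous_cutoff 1).integrable_of_hasCompactSupport (hasCompactSupport_cutoff one_ne_zero)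
  have hexp_int : Integrable fun y => cutoff 1 y * Real.exp (2 * u (r • y)) :=
    integrable_cutoff_mul one_ne_zero (Real.continuous_exp.comp (by fun_prop))
  have hpointwise (y : Plane) : 2 * (cutoff 1 y * u (r • y)) + (2 * Real.log r + 1) * cutoff 1 y
      ≤ r ^ 2 * (cutoff 1 y * Real.exp (2 * u (r • y))) := by
    have hexp_add : r ^ 2 * Real.exp (2 * u (r • y))
        = Real.exp (2 * u (r • y) + 2 * Real.log r) := by
      rw [Real.exp_add, two_mul (Real.log r), Real.exp_add, Real.exp_log hr, ← sq, mul_comm]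
    have htangent := Real.add_one_le_exp (2 * u (r • y) + 2 * Real.log r)
    rw [← hexp_add] at htangent
    linarith [mul_le_mul_of_nonneg_left htangent (cutoff_nonneg 1 y)]
  calc 2 * discIntegral u r + (2 * Real.log r + 1) * (∫ y : Plane, cutoff 1 y)
      = ∫ y, 2 * (cutoff 1 y * u (r • y)) + (2 * Real.log r + 1) * cutoff 1 y := by
        rw [integral_add (hu_int.const_mul _) (hcutoff_int.const_mul _), integral_const_mul,
          integral_const_mul, discIntegral]
    _ ≤ ∫ y, r ^ 2 * (cutoff 1 y * Real.exp (2 * u (r • y))) :=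
        integral_mono ((hu_int.const_mul _).add (hcutoff_int.const_mul _))
          (hexp_int.const_mul _) hpointwise
    _ ≤ ∫ y, Real.exp (2 * u y) := by
        rw [integral_const_mul]
        exact sq_mul_integral_cutoff_mul_exp_le hexp hr

theorem integral_cutoff_pos : 0 < ∫ y : Plane, cutoff 1 y :=
  (continuous_cutoff 1).integral_pos_of_hasCompactSupport_nonneg_nonzero
    (hasCompactSupport_cutoff one_ne_zero) (cutoff_nonneg 1) (x := 0)
    (by rw [cutoff_eq_one_of_norm_le (by simp)]; exact one_ne_zero)

theorem integral_laplacian_neg {u : Plane → ℝ} (hu : ContDiff ℝ 2 u) (hΔ : Integrable (Δ u))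
    (hexp : Integrable fun y => Real.exp (2 * u y)) : ∫ y, Δ u y < 0 := by
  by_contra! hnonneg
  set M := ∫ y : Plane, cutoff 1 y
  have hMpos : 0 < M := integral_cutoff_pos
  have hflux : ∀ᶠ r : ℝ in atTop, -(M / 2) ≤ ∫ y, cutoffPrimitive (‖y‖ ^ 2 / r ^ 2) * Δ u y :=
    (tendsto_integral_comp_norm_sq_div_mul contDiff_cutoffPrimitive.continuous
      (fun _ hs => abs_cutoffPrimitive_le_one hs) hΔ).eventually
        (le_mem_nhds (by nlinarith [cutoffPrimitive_zero_nonneg]))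
  obtain ⟨a, ha⟩ := eventually_atTop.1 (hflux.and (eventually_gt_atTop 0))
  have ha0 : 0 < a := (ha a le_rfl).2
  have hlower {r : ℝ} (hr : a ≤ r) :
      discIntegral u a - M / 2 * (Real.log r - Real.log a) ≤ discIntegral u r :=
    sub_mul_log_le_of_le_mul_deriv ha0
      (fun t _ => hasDerivAt_discIntegral (hu.of_le one_le_two) t)
      (fun t ht => by
        rw [mul_deriv_discIntegral hu (ha0.trans_le ht)]
        exact (ha t ht).1) hr
  have htop : Tendsto (fun r => M * Real.log r) atTop atTop :=
    Real.tendsto_log_atTop.const_mul_atTop hMpos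
  obtain ⟨r, har, hlarge⟩ := ((eventually_ge_atTop a).and (htop.eventually_gt_atTop
    ((∫ y, Real.exp (2 * u y)) - M - 2 * discIntegral u a - M * Real.log a))).exists
  linarith [hlower har, discIntegral_le hu.continuous hexp (ha0.trans_le har)]

theorem integral_cutoff_mul_abs_le {u : Plane → ℝ} (hu : ContDiff ℝ 2 u) (hΔ : Integrable (Δ u))
    (hexp : Integrable fun y => Real.exp (2 * u y)) {r : ℝ} (hr : 1 ≤ r) :
    ∫ y, cutoff 1 y * |u (r • y)|
      ≤ (∫ y, Real.exp (2 * u y)) - discIntegral u 1 + (∫ y, |Δ u y|) * Real.log r := by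
  have hu0 := hu.continuous
  have hexp_int : Integrable fun y => cutoff 1 y * Real.exp (2 * u (r • y)) :=
    integrable_cutoff_mul one_ne_zero (by fun_prop)
  have hu_int : Integrable fun y => cutoff 1 y * u (r • y) :=
    integrable_cutoff_mul one_ne_zero (by fun_prop)
  have hexp_le : ∫ y, cutoff 1 y * Real.exp (2 * u (r • y)) ≤ ∫ y, Real.exp (2 * u y) := by
    refine le_trans (le_mul_of_one_le_left (integral_nonneg fun y => ?_) (one_le_pow₀ hr))
      (sq_mul_integral_cutoff_mul_exp_le hexp (one_pos.trans_le hr))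
    exact mul_nonneg (cutoff_nonneg _ _) (Real.exp_pos _).le
  calc ∫ y, cutoff 1 y * |u (r • y)|
      ≤ ∫ y, (cutoff 1 y * Real.exp (2 * u (r • y)) - cutoff 1 y * u (r • y)) := by
        refine integral_mono (integrable_cutoff_mul one_ne_zero (by fun_prop))
          (hexp_int.sub hu_int) fun y => ?_
        rw [← mul_sub]
        refine mul_le_mul_of_nonneg_left (abs_le.2 ?_) (cutoff_nonneg 1 y)
        have htangent := Real.add_one_le_exp (2 * u (r • y))
        have hpos := Real.exp_pos (2 * u (r • y))
        constructor <;> linarith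
    _ = (∫ y, cutoff 1 y * Real.exp (2 * u (r • y))) - discIntegral u r :=
        integral_sub hexp_int hu_int
    _ ≤ _ := by linarith [discIntegral_one_sub_le hu hΔ hr]

theorem tendsto_inv_mul_integral_cutoff_mul_abs {u : Plane → ℝ} (hu : ContDiff ℝ 2 u)
    (hΔ : Integrable (Δ u)) (hexp : Integrable fun y => Real.exp (2 * u y)) :
    Tendsto (fun r : ℝ => r⁻¹ * ∫ y, cutoff 1 y * |u (r • y)|) atTop (𝓝 0) := by
  have hlog : Tendsto (fun r : ℝ => Real.log r / r) atTop (𝓝 0) :=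
    Real.isLittleO_log_id_atTop.tendsto_div_nhds_zero
  have hbound : Tendsto (fun r : ℝ => r⁻¹ * ((∫ y, Real.exp (2 * u y)) - discIntegral u 1)
      + (∫ y, |Δ u y|) * (Real.log r / r)) atTop (𝓝 0) := by
    simpa using (tendsto_inv_atTop_zero.mul_const _).add (hlog.const_mul _)
  refine squeeze_zero' ?_ ?_ hbound
  · filter_upwards [eventually_ge_atTop 0] with r hr
    exact mul_nonneg (inv_nonneg.2 hr)
      (integral_nonneg fun y => mul_nonneg (cutoff_nonneg _ _) (abs_nonneg _))
  · filter_upwards [eventually_ge_atTop 1] with r hr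
    have hr0 : 0 < r := one_pos.trans_le hr
    refine (mul_le_mul_of_nonneg_left (integral_cutoff_mul_abs_le hu hΔ hexp hr)
      (inv_nonneg.2 hr0.le)).trans_eq ?_
    ring

theorem tendsto_inv_mul_integral_mul_comp_smul {u : Plane → ℝ} (hu : ContDiff ℝ 2 u)
    (hΔ : Integrable (Δ u)) (hexp : Integrable fun y => Real.exp (2 * u y)) {φ : Plane → ℝ}
    (hφ : Continuous φ) (hφc : HasCompactSupport φ) :
    Tendsto (fun r : ℝ => r⁻¹ * ∫ y, φ y * u (r • y)) atTop (𝓝 0) := by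
  have hu0 := hu.continuous
  obtain ⟨C, hC⟩ := hφc.exists_bound_of_continuous hφ
  obtain ⟨lam, hlam, hsupp⟩ := hφc.isCompact.isBounded.exists_pos_norm_le
  have hφ_le (y : Plane) : |φ y| ≤ C * cutoff lam y := by
    by_cases hy : y ∈ tsupport φ
    · simpa [cutoff_eq_one_of_norm_le (hsupp y hy)] using hC y
    · rw [image_eq_zero_of_notMem_tsupport hy, abs_zero]
      exact mul_nonneg ((norm_nonneg _).trans (hC 0)) (cutoff_nonneg _ _)
  have hintegral_le (r : ℝ) : |∫ y, φ y * u (r • y)|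
      ≤ C * (lam ^ 2 * ∫ y, cutoff 1 y * |u ((lam * r) • y)|) := by
    have hscaled : Integrable fun y => C * (cutoff lam y * |u (r • y)|) :=
      (integrable_cutoff_mul hlam.ne' (by fun_prop)).const_mul C
    have hscale : lam ^ 2 * ∫ y, cutoff 1 y * |u ((lam * r) • y)|
        = ∫ y, cutoff lam y * |u (r • y)| := by
      rw [← sq_mul_integral_comp_smul (fun y => cutoff lam y * |u (r • y)|) hlam]
      simp only [cutoff_smul hlam.ne', smul_smul, mul_comm lam r]
    rw [hscale, ← integral_const_mul, ← Real.norm_eq_abs]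
    refine norm_integral_le_of_norm_le hscaled (.of_forall fun y => ?_)
    rw [norm_mul, ← mul_assoc]
    exact mul_le_mul_of_nonneg_right (hφ_le y) (abs_nonneg _)
  have hlimit : Tendsto (fun r : ℝ => C * lam ^ 3
      * ((lam * r)⁻¹ * ∫ y, cutoff 1 y * |u ((lam * r) • y)|)) atTop (𝓝 0) := by
    simpa using ((tendsto_inv_mul_integral_cutoff_mul_abs hu hΔ hexp).comp
      (tendsto_id.const_mul_atTop hlam)).const_mul (C * lam ^ 3)
  refine squeeze_zero_norm' ?_ hlimit
  filter_upwards [eventually_gt_atTop 0] with r hr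
  rw [norm_mul, Real.norm_eq_abs, Real.norm_eq_abs, abs_of_pos (inv_pos.2 hr)]
  refine (mul_le_mul_of_nonneg_left (hintegral_le r) (inv_pos.2 hr).le).trans_eq ?_
  field_simp

end LogarithmicGrowth

section LogarithmicPotential

open Filter Topology

/-- The radial profile of `logKernel`. The division by zero at `s = 0` is harmless since the
numerator vanishes near `0`. -/
noncomputable def logKernelProfile (r s : ℝ) : ℝ := (1 - cutoffProfile (s / r ^ 2)) / s

/-- The gradient kernel `y / ‖y‖ ^ 2` of the logarithmic potential, truncated at scale `r`. -/
noncomputable def logKernel (r : ℝ) (y : Plane) : Plane := logKernelProfile r (‖y‖ ^ 2) • y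

/-- The approximate identity `divergence (logKernel r)`, of total mass `2 * π`. -/
noncomputable def logMollifier (r : ℝ) (y : Plane) : ℝ :=
  -2 * deriv cutoffProfile (‖y‖ ^ 2 / r ^ 2) / r ^ 2

theorem contDiff_logKernelProfile {r : ℝ} (hr : 0 < r) : ContDiff ℝ 1 (logKernelProfile r) := by
  have hnum : ContDiff ℝ 1 fun s => 1 - cutoffProfile (s / r ^ 2) :=
    contDiff_const.sub (contDiff_cutoffProfile.comp (contDiff_id.div_const _))
  rw [contDiff_iff_contDiffAt]
  intro s
  rcases eq_or_ne s 0 with rfl | hs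
  · have hzero : logKernelProfile r =ᶠ[𝓝 0] fun _ => 0 := by
      filter_upwards [gt_mem_nhds (show (0 : ℝ) < r ^ 2 by positivity)] with t ht
      rw [logKernelProfile, cutoffProfile_of_le_one ((div_le_one (by positivity)).2 ht.le),
        sub_self, zero_div]
    exact contDiffAt_const.congr_of_eventuallyEq hzero
  · exact hnum.contDiffAt.div contDiffAt_id hs

theorem contDiff_logKernel {r : ℝ} (hr : 0 < r) : ContDiff ℝ 1 (logKernel r) :=
  ((contDiff_logKernelProfile hr).comp (contDiff_norm_sq ℝ)).smul contDiff_id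

theorem logKernel_neg (r : ℝ) (y : Plane) : logKernel r (-y) = -logKernel r y := by
  simp [logKernel]

theorem norm_logKernel_le {r : ℝ} (hr : 0 < r) (y : Plane) : ‖logKernel r y‖ ≤ r⁻¹ := by
  rcases le_or_gt ‖y‖ r with hy | hy
  · have hone : cutoffProfile (‖y‖ ^ 2 / r ^ 2) = 1 := cutoff_eq_one_of_norm_le hy
    simp [logKernel, logKernelProfile, hone, hr.le]
  · have hy0 : 0 < ‖y‖ := hr.trans hy
    have hnum : |1 - cutoffProfile (‖y‖ ^ 2 / r ^ 2)| ≤ 1 :=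
      abs_le.2 ⟨by linarith [cutoffProfile_le_one (‖y‖ ^ 2 / r ^ 2)],
        by linarith [cutoffProfile_nonneg (‖y‖ ^ 2 / r ^ 2)]⟩
    calc ‖logKernel r y‖ = |1 - cutoffProfile (‖y‖ ^ 2 / r ^ 2)| * ‖y‖⁻¹ := by
          rw [logKernel, logKernelProfile, norm_smul, Real.norm_eq_abs, abs_div, abs_pow, abs_norm]
          field_simp
      _ ≤ 1 * r⁻¹ := by gcongr
      _ = r⁻¹ := one_mul _

theorem logKernelProfile_of_le {r s : ℝ} (hr : 0 < r) (hs : 2 * r ^ 2 ≤ s) :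
    logKernelProfile r s = 1 / s := by
  rw [logKernelProfile, cutoffProfile_of_two_le (by rwa [le_div_iff₀ (by positivity)]), sub_zero]

theorem divergence_logKernel {r : ℝ} (hr : 0 < r) (y : Plane) :
    divergence (logKernel r) y = logMollifier r y := by
  have hdiff := (contDiff_logKernelProfile hr).differentiable one_ne_zero
  have hproduct : (fun s => s * logKernelProfile r s) = fun s => 1 - cutoffProfile (s / r ^ 2) := by
    funext s
    rcases eq_or_ne s 0 with rfl | hs
    · simp [cutoffProfile_of_le_one zero_le_one]
    · rw [logKernelProfile, mul_div_cancel₀ _ hs]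
  have hderiv_product (s : ℝ) : HasDerivAt (fun s => s * logKernelProfile r s)
      (1 * logKernelProfile r s + s * deriv (logKernelProfile r) s) s :=
    (hasDerivAt_id' s).mul (hdiff s).hasDerivAt
  have hderiv_num (s : ℝ) : HasDerivAt (fun s => 1 - cutoffProfile (s / r ^ 2))
      (-(deriv cutoffProfile (s / r ^ 2) * (1 / r ^ 2))) s :=
    ((differentiable_cutoffProfile _).hasDerivAt.comp s
      ((hasDerivAt_id' s).div_const _)).const_sub 1
  have hunique := (hproduct ▸ hderiv_product (‖y‖ ^ 2)).unique (hderiv_num (‖y‖ ^ 2))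
  have hdiv : divergence (logKernel r) y = 2 * logKernelProfile r (‖y‖ ^ 2)
      + 2 * ‖y‖ ^ 2 * deriv (logKernelProfile r) (‖y‖ ^ 2) := by
    have hradial := divergence_radial_smul hdiff y
    rw [finrank_euclideanSpace_fin] at hradial
    exact_mod_cast hradial
  rw [hdiv, logMollifier]
  linear_combination 2 * hunique

theorem hasCompactSupport_logKernel_sub {r R : ℝ} (hr : 0 < r) (hR : 0 < R) :
    HasCompactSupport fun y => logKernel r y - logKernel R y := by
  have hprofile : HasCompactSupport fun y : Plane =>
      logKernelProfile r (‖y‖ ^ 2) - logKernelProfile R (‖y‖ ^ 2) :=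
    hasCompactSupport_comp_norm_sq (q := fun s => logKernelProfile r s - logKernelProfile R s)
      (S := 2 * r ^ 2 + 2 * R ^ 2) fun s hs => by
        rw [logKernelProfile_of_le hr (by nlinarith), logKernelProfile_of_le hR (by nlinarith),
          sub_self]
  have hsmul : HasCompactSupport fun y : Plane =>
      (logKernelProfile r (‖y‖ ^ 2) - logKernelProfile R (‖y‖ ^ 2)) • y := hprofile.smul_right
  simpa only [logKernel, ← sub_smul] using hsmul

theorem continuous_logMollifier (r : ℝ) : Continuous (logMollifier r) :=
  (continuous_const.mul (contDiff_deriv_cutoffProfile.continuous.comp (by fun_prop))).div_const _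

theorem hasCompactSupport_logMollifier {r : ℝ} (hr : 0 < r) :
    HasCompactSupport (logMollifier r) :=
  hasCompactSupport_comp_norm_sq (q := fun s => -2 * deriv cutoffProfile (s / r ^ 2) / r ^ 2)
    (S := 2 * r ^ 2) fun s hs => by
      simp [deriv_cutoffProfile_of_two_le ((le_div_iff₀ (by positivity)).2 hs)]

theorem integral_logMollifier_mul {r : ℝ} (hr : 0 < r) (g : Plane → ℝ) :
    ∫ y, logMollifier r y * g y = ∫ y, logMollifier 1 y * g (r • y) := by
  have hscale (y : Plane) : logMollifier r (r • y) * g (r • y)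
      = (r ^ 2)⁻¹ * (logMollifier 1 y * g (r • y)) := by
    rw [logMollifier, logMollifier, norm_smul, Real.norm_eq_abs, mul_pow, sq_abs,
      mul_div_cancel_left₀ _ (by positivity)]
    simp only [one_pow, div_one]
    ring
  rw [← sq_mul_integral_comp_smul _ hr, integral_congr_ae (.of_forall hscale), integral_const_mul,
    mul_inv_cancel_left₀ (by positivity)]

theorem integral_logKernel_mul_laplacian_add {u : Plane → ℝ} (hu : ContDiff ℝ 2 u)
    (hΔ : Integrable (Δ u)) {r R : ℝ} (hr : 0 < r) (hR : 0 < R) (v : Plane) :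
    (∫ y, inner ℝ (logKernel r y) v * Δ u y) + ∫ y, logMollifier r y * fderiv ℝ u y v =
      (∫ y, inner ℝ (logKernel R y) v * Δ u y) + ∫ y, logMollifier R y * fderiv ℝ u y v := by
  have hdiff {t : ℝ} (ht : 0 < t) (y : Plane) : DifferentiableAt ℝ (logKernel t) y :=
    (contDiff_logKernel ht).differentiable one_ne_zero y
  have hsymm (y a b : Plane) :
      inner ℝ (fderiv ℝ (fun y => logKernel r y - logKernel R y) y a) b
        = inner ℝ a (fderiv ℝ (fun y => logKernel r y - logKernel R y) y b) := by
    have hsymm_kernel {t : ℝ} (ht : 0 < t) :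
        inner ℝ (fderiv ℝ (logKernel t) y a) b = inner ℝ a (fderiv ℝ (logKernel t) y b) :=
      inner_fderiv_radial_smul_comm ((contDiff_logKernelProfile ht).differentiable one_ne_zero)
        y a b
    simp [fderiv_fun_sub (hdiff hr y) (hdiff hR y), inner_sub_left, inner_sub_right,
      hsymm_kernel hr, hsymm_kernel hR]
  have hdiv (y : Plane) : divergence (fun y => logKernel r y - logKernel R y) y
      = logMollifier r y - logMollifier R y := by
    simp only [divergence, fderiv_fun_sub (hdiff hr y) (hdiff hR y),
      ContinuousLinearMap.toLinearMap_sub, map_sub]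
    rw [← divergence_logKernel hr, ← divergence_logKernel hR, divergence, divergence]
  have hkernel_int {t : ℝ} (ht : 0 < t) : Integrable fun y => inner ℝ (logKernel t y) v * Δ u y :=
    hΔ.bdd_mul ((contDiff_logKernel ht).continuous.inner continuous_const).aestronglyMeasurable
      (.of_forall fun y => (norm_inner_le_norm _ _).trans
        (mul_le_mul_of_nonneg_right (norm_logKernel_le ht y) (norm_nonneg v)))
  have hmollifier_int {t : ℝ} (ht : 0 < t) :
      Integrable fun y => logMollifier t y * fderiv ℝ u y v :=
    ((continuous_logMollifier t).mul ((hu.continuous_fderiv two_ne_zero).clm_apply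
      continuous_const)).integrable_of_hasCompactSupport
        (hasCompactSupport_logMollifier ht).mul_right
  have hgreen := integral_inner_mul_laplacian volume
    ((contDiff_logKernel hr).sub (contDiff_logKernel hR)) (hasCompactSupport_logKernel_sub hr hR)
    hsymm hu v
  simp only [hdiv, inner_sub_left, sub_mul] at hgreen
  rw [integral_sub (hkernel_int hr) (hkernel_int hR),
    integral_sub (hmollifier_int hr) (hmollifier_int hR)] at hgreen
  linarith

theorem tendsto_integral_logMollifier_mul_fderiv {u : Plane → ℝ} (hu : ContDiff ℝ 2 u)
    (hΔ : Integrable (Δ u)) (hexp : Integrable fun y => Real.exp (2 * u y)) (v : Plane) :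
    Tendsto (fun R : ℝ => ∫ y, logMollifier R y * fderiv ℝ u y v) atTop (𝓝 0) := by
  have hsmooth : ContDiff ℝ 1 (logMollifier 1) :=
    (contDiff_const.mul (contDiff_deriv_cutoffProfile.comp
      ((contDiff_norm_sq ℝ).div_const _))).div_const _
  have hsupp := hasCompactSupport_logMollifier one_pos
  have hcont : Continuous fun y => -fderiv ℝ (logMollifier 1) y v :=
    ((hsmooth.continuous_fderiv one_ne_zero).clm_apply continuous_const).neg
  refine (tendsto_inv_mul_integral_mul_comp_smul hu hΔ hexp hcont
    (hsupp.fderiv_apply (𝕜 := ℝ) v).neg).congr' ?_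
  filter_upwards [eventually_gt_atTop 0] with R hR
  have hdilate : ContDiff ℝ 1 fun y => u (R • y) :=
    (hu.of_le one_le_two).comp (contDiff_id.const_smul R)
  have hfield : ContDiff ℝ 1 fun y => logMollifier 1 y • v := hsmooth.smul contDiff_const
  have hparts := integral_mul_divergence volume hdilate hfield (.inr hsupp.smul_right)
  have hdiv (y : Plane) : divergence (fun y => logMollifier 1 y • v) y
      = fderiv ℝ (logMollifier 1) y v := by
    rw [divergence_smul (hsmooth.differentiable one_ne_zero y) (differentiableAt_const v)]
    simp [divergence]
  have hfderiv (y : Plane) : fderiv ℝ (fun y => u (R • y)) y (logMollifier 1 y • v)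
      = R * (logMollifier 1 y * fderiv ℝ u (R • y) v) := by
    simp [fderiv_comp_smul, mul_left_comm]
  simp only [hdiv, hfderiv, integral_const_mul] at hparts
  rw [integral_logMollifier_mul hR]
  simp only [neg_mul, integral_neg, mul_comm (fderiv ℝ (logMollifier 1) _ v), hparts, neg_neg]
  exact inv_mul_cancel_left₀ hR.ne' _

theorem integral_logKernel_mul_laplacian {u : Plane → ℝ} (hu : ContDiff ℝ 2 u)
    (hΔ : Integrable (Δ u)) (hexp : Integrable fun y => Real.exp (2 * u y)) {r : ℝ} (hr : 0 < r)
    (v : Plane) :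
    ∫ y, inner ℝ (logKernel r y) v * Δ u y = -∫ y, logMollifier r y * fderiv ℝ u y v := by
  have hkernel : Tendsto (fun R : ℝ => ∫ y, inner ℝ (logKernel R y) v * Δ u y) atTop (𝓝 0) := by
    have hbound : Tendsto (fun R : ℝ => R⁻¹ * ‖v‖ * ∫ y, |Δ u y|) atTop (𝓝 0) := by
      simpa using (tendsto_inv_atTop_zero.mul_const ‖v‖).mul_const (∫ y, |Δ u y|)
    refine squeeze_zero_norm' ?_ hbound
    filter_upwards [eventually_gt_atTop 0] with R hR
    rw [← integral_const_mul]
    refine norm_integral_le_of_norm_le (hΔ.abs.const_mul _) (.of_forall fun y => ?_)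
    rw [norm_mul]
    exact mul_le_mul_of_nonneg_right ((norm_inner_le_norm _ _).trans
      (mul_le_mul_of_nonneg_right (norm_logKernel_le hR y) (norm_nonneg v))) (norm_nonneg _)
  have hsum := hkernel.add (tendsto_integral_logMollifier_mul_fderiv hu hΔ hexp v)
  refine eq_neg_of_add_eq_zero_left
    ((tendsto_nhds_unique (tendsto_const_nhds.congr' ?_) hsum).trans (add_zero 0))
  filter_upwards [eventually_gt_atTop 0] with R hR using
    integral_logKernel_mul_laplacian_add hu hΔ hr hR v

theorem laplacian_comp_add_left {E : Type*} [NormedAddCommGroup E] [InnerProductSpace ℝ E]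
    [FiniteDimensional ℝ E] (u : E → ℝ) (x y : E) : Δ (fun y => u (x + y)) y = Δ u (x + y) := by
  simp only [InnerProductSpace.laplacian_eq_iteratedFDeriv_stdOrthonormalBasis,
    iteratedFDeriv_comp_add_left]

theorem integral_logKernel_sub_mul_laplacian {u : Plane → ℝ} (hu : ContDiff ℝ 2 u)
    (hΔ : Integrable (Δ u)) (hexp : Integrable fun y => Real.exp (2 * u y)) {r : ℝ} (hr : 0 < r)
    (x v : Plane) :
    ∫ z, inner ℝ (logKernel r (z - x)) v * Δ u z
      = -∫ y, logMollifier 1 y * fderiv ℝ u (x + r • y) v := by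
  have hrep := integral_logKernel_mul_laplacian (u := fun y => u (x + y))
    (hu.comp (contDiff_const.add contDiff_id))
    (by simpa only [funext (laplacian_comp_add_left u x)] using hΔ.comp_add_left x)
    (hexp.comp_add_left x) hr v
  simp only [laplacian_comp_add_left, fderiv_comp_add_left, integral_logMollifier_mul hr] at hrep
  rw [← hrep, ← integral_add_left_eq_self _ x]
  simp only [add_sub_cancel_left]

theorem integral_deriv_comp_norm_sq {p : ℝ → ℝ} (hp : ContDiff ℝ 1 p) {S : ℝ}
    (hS : ∀ s, S ≤ s → p s = 0) : ∫ y : Plane, deriv p (‖y‖ ^ 2) = -(Real.pi * p 0) := by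
  have hball : volume.real (Metric.ball (0 : Plane) 1) = Real.pi := by
    rw [Measure.real, EuclideanSpace.volume_ball_fin_two]
    simp [Real.pi_pos.le]
  have hpolar := integral_fun_norm_addHaar (volume : Measure Plane) fun t => deriv p (t ^ 2)
  simp only [finrank_euclideanSpace_fin, hball, smul_eq_mul, Nat.add_one_sub_one, pow_one,
    nsmul_eq_mul, Nat.cast_ofNat] at hpolar
  have hderiv (t : ℝ) : HasDerivAt (fun t => p (t ^ 2)) (t * (2 * deriv p (t ^ 2))) t :=
    ((hp.differentiable one_ne_zero _).hasDerivAt.comp t (hasDerivAt_pow 2 t)).congr_deriv (by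
      simp only [Nat.add_one_sub_one, pow_one, Nat.cast_ofNat]
      ring)
  have hsupp : HasCompactSupport fun t : ℝ => p (t ^ 2) := by
    simpa only [Real.norm_eq_abs, sq_abs] using hasCompactSupport_comp_norm_sq (E := ℝ) hS
  have hint : Integrable fun t : ℝ => t * (2 * deriv p (t ^ 2)) := by
    have hcont : Continuous fun t : ℝ => t * (2 * deriv p (t ^ 2)) :=
      continuous_id.mul (continuous_const.mul (hp.continuous_deriv_one.comp (continuous_pow 2)))
    refine hcont.integrable_of_hasCompactSupport ?_
    simpa only [funext fun t => (hderiv t).deriv] using hsupp.deriv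
  have hradial : ∫ t in Set.Ioi (0 : ℝ), t * (2 * deriv p (t ^ 2)) = 0 - p (0 ^ 2) :=
    integral_Ioi_of_hasDerivAt_of_tendsto' (fun t _ => hderiv t) hint.integrableOn
      (hsupp.is_zero_at_infty.mono_left _root_.atTop_le_cocompact)
  rw [hpolar]
  simp only [mul_left_comm _ (2 : ℝ), integral_const_mul] at hradial
  simp only [ne_eq, OfNat.ofNat_ne_zero, not_false_eq_true, zero_pow, zero_sub] at hradial
  linear_combination Real.pi * hradial

theorem integral_logMollifier : ∫ y, logMollifier 1 y = 2 * Real.pi := by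
  simp only [logMollifier, one_pow, div_one]
  rw [integral_const_mul, integral_deriv_comp_norm_sq contDiff_cutoffProfile
    fun _ => cutoffProfile_of_two_le, cutoffProfile_of_le_one zero_le_one]
  ring

end LogarithmicPotential

section Symmetrization

open Filter Topology

theorem ae_fst_ne_snd {α : Type*} [MeasurableSpace α] [MeasurableEq α] {μ : Measure α} [SFinite μ]
    [NullSingletonClass μ] : ∀ᵐ q ∂μ.prod μ, q.1 ≠ q.2 := by
  have hnull : μ.prod μ (Set.diagonal α) = 0 := by
    rw [Measure.measure_prod_null measurableSet_diagonal]
    exact .of_forall fun x => by simp [Set.diagonal, Set.preimage]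
  simpa [ae_iff, Set.diagonal] using hnull

section InnerProductSpace

variable {E : Type*} [NormedAddCommGroup E] [InnerProductSpace ℝ E]

/-- The radial difference quotient `⟪x - z, V x - V z⟫ / ‖x - z‖ ^ 2` of a vector field `V` at the
pair `q = (x, z)`. It takes the junk value `0` on the diagonal. -/
noncomputable def radialQuotient (V : E → E) (q : E × E) : ℝ :=
  inner ℝ (q.1 - q.2) (V q.1 - V q.2) / ‖q.1 - q.2‖ ^ 2

theorem abs_radialQuotient_le {V : E → E} {C : NNReal} (hV : LipschitzWith C V) (q : E × E) :
    |radialQuotient V q| ≤ C := by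
  rw [radialQuotient, abs_div, abs_of_nonneg (sq_nonneg ‖q.1 - q.2‖)]
  refine div_le_of_le_mul₀ (sq_nonneg _) C.2 ?_
  calc |inner ℝ (q.1 - q.2) (V q.1 - V q.2)| ≤ ‖q.1 - q.2‖ * ‖V q.1 - V q.2‖ :=
        abs_real_inner_le_norm _ _
    _ ≤ ‖q.1 - q.2‖ * (C * ‖q.1 - q.2‖) := by
        gcongr
        exact hV.norm_sub_le _ _
    _ = C * ‖q.1 - q.2‖ ^ 2 := by ring

variable [MeasurableSpace E] [BorelSpace E] [SecondCountableTopology E] {μ : Measure E} [SFinite μ]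

theorem measurable_radialQuotient {V : E → E} (hV : Continuous V) :
    Measurable (radialQuotient V) := by
  have hnum : Continuous fun q : E × E => inner ℝ (q.1 - q.2) (V q.1 - V q.2) := by fun_prop
  have hden : Continuous fun q : E × E => ‖q.1 - q.2‖ ^ 2 := by fun_prop
  exact hnum.measurable.div hden.measurable

theorem integral_mul_integral_inner_sub_of_odd {k V : E → E} (hk : Continuous k)
    (hodd : ∀ y, k (-y) = -k y) {A : ℝ} (hA : ∀ y, ‖k y‖ ≤ A) (hV : Continuous V) {B : ℝ}
    (hB : ∀ x, ‖V x‖ ≤ B) {D : E → ℝ} (hD : Integrable D μ) :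
    ∫ x, D x * ∫ z, inner ℝ (k (z - x)) (V x) * D z ∂μ ∂μ
      = -(1 / 2) * ∫ q, inner ℝ (k (q.1 - q.2)) (V q.1 - V q.2) * (D q.1 * D q.2) ∂μ.prod μ := by
  set G : E × E → ℝ := fun q => inner ℝ (k (q.2 - q.1)) (V q.1) * (D q.1 * D q.2) with hG
  have hkernel : Continuous fun q : E × E => inner ℝ (k (q.2 - q.1)) (V q.1) := by fun_prop
  have hG_int : Integrable G (μ.prod μ) :=
    (hD.mul_prod hD).bdd_mul hkernel.aestronglyMeasurable (.of_forall fun q =>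
      (norm_inner_le_norm _ _).trans
        (mul_le_mul (hA _) (hB _) (norm_nonneg _) ((norm_nonneg _).trans (hA 0))))
  have hiterated : ∫ x, D x * ∫ z, inner ℝ (k (z - x)) (V x) * D z ∂μ ∂μ
      = ∫ q, G q ∂μ.prod μ := by
    rw [integral_prod _ hG_int]
    simp only [hG, mul_left_comm _ (D _), integral_const_mul]
  have hsymm (q : E × E) :
      inner ℝ (k (q.1 - q.2)) (V q.1 - V q.2) * (D q.1 * D q.2) = -(G q + G q.swap) := by
    simp only [hG, Prod.fst_swap, Prod.snd_swap]
    rw [← neg_sub q.1 q.2, hodd, inner_neg_left, inner_sub_right]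
    ring
  have hswap : ∫ q, G q.swap ∂μ.prod μ = ∫ q, G q ∂μ.prod μ := integral_prod_swap G
  have hadd : ∫ q, (G q + G q.swap) ∂μ.prod μ
      = (∫ q, G q ∂μ.prod μ) + ∫ q, G q.swap ∂μ.prod μ := integral_add hG_int hG_int.swap
  simp only [hiterated, hsymm, integral_neg, hadd, hswap]
  ring

theorem tendsto_integral_radialQuotient_mul {ι : Type*} {l : Filter ι} [l.IsCountablyGenerated]
    [NullSingletonClass μ] {V : ι → E → E} {C : NNReal} (hV : ∀ᶠ i in l, LipschitzWith C (V i))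
    (hlim : ∀ x, ∀ᶠ i in l, V i x = x) {D : E → ℝ} (hD : Integrable D μ) :
    Tendsto (fun i => ∫ q, radialQuotient (V i) q * (D q.1 * D q.2) ∂μ.prod μ) l
      (𝓝 ((∫ x, D x ∂μ) ^ 2)) := by
  have hDD := hD.mul_prod hD
  rw [sq, ← integral_prod_mul]
  refine tendsto_integral_filter_of_dominated_convergence (fun q => C * |D q.1 * D q.2|)
    ?_ ?_ (hDD.abs.const_mul _) ?_
  · filter_upwards [hV] with i hi
    exact (measurable_radialQuotient hi.continuous).aestronglyMeasurable.mul
      hDD.aestronglyMeasurable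
  · filter_upwards [hV] with i hi
    refine .of_forall fun q => ?_
    rw [norm_mul]
    exact mul_le_mul_of_nonneg_right (abs_radialQuotient_le hi q) (norm_nonneg _)
  · filter_upwards [ae_fst_ne_snd] with q hq
    refine tendsto_const_nhds.congr' ?_
    filter_upwards [hlim q.1, hlim q.2] with i hfst hsnd
    have hnorm : ‖q.1 - q.2‖ ≠ 0 := norm_ne_zero_iff.2 (sub_ne_zero.2 hq)
    rw [radialQuotient, hfst, hsnd, real_inner_self_eq_norm_sq, div_self (pow_ne_zero 2 hnorm),
      one_mul]

end InnerProductSpace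

theorem inner_logKernel_sub (r : ℝ) (V : Plane → Plane) (q : Plane × Plane) :
    inner ℝ (logKernel r (q.1 - q.2)) (V q.1 - V q.2)
      = (1 - cutoff r (q.1 - q.2)) * radialQuotient V q := by
  rw [logKernel, logKernelProfile, real_inner_smul_left, radialQuotient, cutoff]
  ring

theorem tendsto_one_sub_cutoff_nhdsGT_zero {E : Type*} [NormedAddCommGroup E] {x : E}
    (hx : x ≠ 0) : Tendsto (fun r : ℝ => 1 - cutoff r x) (𝓝[>] 0) (𝓝 1) := by
  refine tendsto_const_nhds.congr' ?_
  filter_upwards [Ioo_mem_nhdsGT (half_pos (norm_pos_iff.2 hx))] with r hr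
  have hscale : 2 ≤ ‖x‖ ^ 2 / r ^ 2 := by
    rw [le_div_iff₀ (pow_pos hr.1 2)]
    nlinarith [hr.1, hr.2]
  rw [cutoff, cutoffProfile_of_two_le hscale, sub_zero]

theorem tendsto_integral_inner_logKernel_mul {V : Plane → Plane} {C : NNReal}
    (hV : LipschitzWith C V) {D : Plane → ℝ} (hD : Integrable D) :
    Tendsto (fun r : ℝ => ∫ q, inner ℝ (logKernel r (q.1 - q.2)) (V q.1 - V q.2)
        * (D q.1 * D q.2) ∂volume.prod volume) (𝓝[>] 0)
      (𝓝 (∫ q, radialQuotient V q * (D q.1 * D q.2) ∂volume.prod volume)) := by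
  have hDD := hD.mul_prod hD
  simp only [inner_logKernel_sub]
  refine tendsto_integral_filter_of_dominated_convergence (fun q => C * |D q.1 * D q.2|)
    (.of_forall fun r => ?_) (.of_forall fun r => .of_forall fun q => ?_) (hDD.abs.const_mul _)
    (.of_forall fun q => ?_)
  · have hcut : Continuous fun q : Plane × Plane => 1 - cutoff r (q.1 - q.2) :=
      continuous_const.sub ((continuous_cutoff r).comp (by fun_prop))
    exact (hcut.measurable.mul (measurable_radialQuotient
      hV.continuous)).aestronglyMeasurable.mul hDD.aestronglyMeasurable
  · rw [norm_mul, norm_mul, Real.norm_eq_abs, Real.norm_eq_abs,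
      abs_of_nonneg (sub_nonneg.2 (cutoff_le_one _ _))]
    refine mul_le_mul_of_nonneg_right ?_ (abs_nonneg _)
    exact (mul_le_of_le_one_left (abs_nonneg _) (sub_le_self _ (cutoff_nonneg _ _))).trans
      (abs_radialQuotient_le hV q)
  · refine Tendsto.mul_const _ ?_
    by_cases hq : q.1 = q.2
    · simp [radialQuotient, hq]
    · simpa using (tendsto_one_sub_cutoff_nhdsGT_zero (sub_ne_zero.2 hq)).mul_const
        (radialQuotient V q)

theorem tendsto_integral_logMollifier_mul_fderiv_add_smul {u : Plane → ℝ} (hu : ContDiff ℝ 1 u)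
    {D : Plane → ℝ} (hD : Continuous D) {V : Plane → Plane} (hV : Continuous V)
    (hc : HasCompactSupport V) :
    Tendsto (fun r : ℝ => ∫ x, D x * ∫ y, logMollifier 1 y * fderiv ℝ u (x + r • y) (V x)) (𝓝 0)
      (𝓝 (2 * Real.pi * ∫ x, D x * fderiv ℝ u x (V x))) := by
  have hdu : Continuous (fderiv ℝ u) := hu.continuous_fderiv one_ne_zero
  have hinner : Continuous fun p : ℝ × Plane =>
      ∫ y, logMollifier 1 y * fderiv ℝ u (p.2 + p.1 • y) (V p.2) := by
    rw [← continuousOn_univ]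
    refine continuousOn_integral_of_compact_support (k := tsupport (logMollifier 1))
      (hasCompactSupport_logMollifier one_pos) (Continuous.continuousOn ?_) fun p y _ hy => ?_
    · exact ((continuous_logMollifier 1).comp continuous_snd).mul
        ((hdu.comp (by fun_prop)).clm_apply (hV.comp (by fun_prop)))
    · rw [image_eq_zero_of_notMem_tsupport hy, zero_mul]
  have houter : Continuous fun r : ℝ =>
      ∫ x, D x * ∫ y, logMollifier 1 y * fderiv ℝ u (x + r • y) (V x) := by
    rw [← continuousOn_univ]
    refine continuousOn_integral_of_compact_support (k := tsupport V) hc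
      ((hD.comp continuous_snd).mul hinner).continuousOn fun r x _ hx => ?_
    simp [image_eq_zero_of_notMem_tsupport hx]
  refine houter.tendsto' 0 _ ?_
  simp only [zero_smul, add_zero, integral_mul_const, integral_logMollifier]
  simp only [mul_left_comm _ (2 * Real.pi), integral_const_mul]

theorem integral_laplacian_mul_fderiv {u : Plane → ℝ} (hu : ContDiff ℝ 2 u)
    (hΔ : Integrable (Δ u)) (hexp : Integrable fun y => Real.exp (2 * u y)) {V : Plane → Plane}
    {C : NNReal} (hV : LipschitzWith C V) (hc : HasCompactSupport V) :
    2 * Real.pi * ∫ x, Δ u x * fderiv ℝ u x (V x)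
      = 1 / 2 * ∫ q, radialQuotient V q * (Δ u q.1 * Δ u q.2) ∂volume.prod volume := by
  obtain ⟨B, hB⟩ := hc.exists_bound_of_continuous hV.continuous
  have hmollified := (tendsto_integral_logMollifier_mul_fderiv_add_smul (hu.of_le one_le_two)
    (continuous_laplacian hu) hV.continuous hc).mono_left (nhdsWithin_le_nhds (s := Set.Ioi 0))
  refine tendsto_nhds_unique (hmollified.congr' ?_)
    ((tendsto_integral_inner_logKernel_mul hV hΔ).const_mul (1 / 2))
  filter_upwards [self_mem_nhdsWithin] with r hr
  have hsymmetrized := integral_mul_integral_inner_sub_of_odd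
    (contDiff_logKernel hr).continuous (logKernel_neg r) (norm_logKernel_le hr) hV.continuous hB hΔ
  simp only [integral_logKernel_sub_mul_laplacian hu hΔ hexp hr, mul_neg, integral_neg]
    at hsymmetrized
  linarith

section DilationField

variable {E : Type*} [NormedAddCommGroup E] [InnerProductSpace ℝ E]

/-- The generator `x ↦ x` of dilations, cut off at scale `r`. -/
noncomputable def dilationField (r : ℝ) (x : E) : E := cutoff r x • x

theorem contDiff_dilationField {n : ℕ∞} (r : ℝ) : ContDiff ℝ n (dilationField r : E → E) :=
  (contDiff_cutoff r).smul contDiff_id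

theorem dilationField_of_norm_le {r : ℝ} {x : E} (hx : ‖x‖ ≤ r) : dilationField r x = x := by
  rw [dilationField, cutoff_eq_one_of_norm_le hx, one_smul]

theorem dilationField_eq_smul {r : ℝ} (hr : r ≠ 0) (x : E) :
    dilationField r x = r • dilationField 1 (r⁻¹ • x) := by
  rw [dilationField, dilationField, ← cutoff_smul hr, smul_inv_smul₀ hr, smul_comm,
    smul_inv_smul₀ hr]

variable [FiniteDimensional ℝ E]

theorem hasCompactSupport_dilationField {r : ℝ} (hr : r ≠ 0) :
    HasCompactSupport (dilationField r : E → E) :=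
  (hasCompactSupport_cutoff hr).smul_right

variable (E) in
theorem exists_lipschitzWith_dilationField :
    ∃ C, ∀ r : ℝ, r ≠ 0 → LipschitzWith C (dilationField r : E → E) := by
  obtain ⟨C, hC⟩ := ContDiff.lipschitzWith_of_hasCompactSupport
    (hasCompactSupport_dilationField (E := E) one_ne_zero) (contDiff_dilationField (n := 1) 1)
    one_ne_zero
  refine ⟨C, fun r hr => ?_⟩
  have hscaled := (lipschitzWith_smul r).comp (hC.comp (lipschitzWith_smul (β := E) r⁻¹))
  have hconst : ‖r‖₊ * (C * ‖r⁻¹‖₊) = C := by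
    rw [nnnorm_inv, mul_left_comm, mul_inv_cancel₀ (nnnorm_ne_zero_iff.2 hr), mul_one]
  rw [hconst] at hscaled
  rwa [funext (dilationField_eq_smul hr)]

end DilationField

theorem tendsto_integral_laplacian_mul_fderiv_dilationField {u : Plane → ℝ} (hu : ContDiff ℝ 2 u)
    (hΔ : Integrable (Δ u)) (hexp : Integrable fun y => Real.exp (2 * u y)) :
    Tendsto (fun R : ℝ => ∫ x, Δ u x * fderiv ℝ u x (dilationField R x)) atTop
      (𝓝 ((∫ x, Δ u x) ^ 2 / (4 * Real.pi))) := by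
  obtain ⟨C, hC⟩ := exists_lipschitzWith_dilationField Plane
  have hquotient : Tendsto (fun R : ℝ => ∫ q, radialQuotient (dilationField R) q
      * (Δ u q.1 * Δ u q.2) ∂volume.prod volume) atTop (𝓝 ((∫ x, Δ u x) ^ 2)) := by
    refine tendsto_integral_radialQuotient_mul (C := C) ?_ (fun x => ?_) hΔ
    · filter_upwards [eventually_ne_atTop 0] with R hR using hC R hR
    · filter_upwards [eventually_ge_atTop ‖x‖] with R hR using dilationField_of_norm_le hR
  refine (hquotient.div_const (4 * Real.pi)).congr' ?_
  filter_upwards [eventually_ne_atTop 0] with R hR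
  have hrep := integral_laplacian_mul_fderiv hu hΔ hexp (hC R hR)
    (hasCompactSupport_dilationField hR)
  rw [div_eq_iff (by positivity)]
  linarith

end Symmetrization

section Pohozaev

open Filter Topology

section InnerProductSpace

variable {E : Type*} [NormedAddCommGroup E] [InnerProductSpace ℝ E] [FiniteDimensional ℝ E]

/-- The profile of `divergence (dilationField r)`, for `n = finrank ℝ E`. -/
noncomputable def dilationDivergenceProfile (n : ℕ) (s : ℝ) : ℝ :=
  n * cutoffProfile s + 2 * s * deriv cutoffProfile s

theorem divergence_dilationField (r : ℝ) (x : E) :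
    divergence (dilationField r) x
      = dilationDivergenceProfile (Module.finrank ℝ E) (‖x‖ ^ 2 / r ^ 2) := by
  have hprofile (s : ℝ) : HasDerivAt (fun s => cutoffProfile (s / r ^ 2))
      (deriv cutoffProfile (s / r ^ 2) * (1 / r ^ 2)) s :=
    (differentiable_cutoffProfile _).hasDerivAt.comp s ((hasDerivAt_id' s).div_const _)
  have hradial := divergence_radial_smul (E := E) (fun s => (hprofile s).differentiableAt) x
  rw [(hprofile _).deriv] at hradial
  refine hradial.trans ?_
  rw [dilationDivergenceProfile]
  ring

theorem continuous_dilationDivergenceProfile (n : ℕ) :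
    Continuous (dilationDivergenceProfile n) :=
  (continuous_const.mul continuous_cutoffProfile).add
    ((continuous_const.mul continuous_id).mul contDiff_deriv_cutoffProfile.continuous)

theorem exists_abs_dilationDivergenceProfile_le (n : ℕ) :
    ∃ C, ∀ s, 0 ≤ s → |dilationDivergenceProfile n s| ≤ C := by
  obtain ⟨C, hC⟩ := isCompact_Icc.exists_bound_of_continuousOn (s := Set.Icc (0 : ℝ) 2)
    (continuous_dilationDivergenceProfile n).continuousOn
  refine ⟨C, fun s hs => ?_⟩
  rcases le_total s 2 with hs2 | hs2
  · exact hC s ⟨hs, hs2⟩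
  · rw [dilationDivergenceProfile, cutoffProfile_of_two_le hs2, deriv_cutoffProfile_of_two_le hs2]
    simpa using (norm_nonneg _).trans (hC 0 ⟨le_rfl, zero_le_two⟩)

variable [MeasurableSpace E] [BorelSpace E] (μ : Measure E)

theorem tendsto_integral_divergence_dilationField_mul {D : E → ℝ} (hD : Integrable D μ) :
    Tendsto (fun r : ℝ => ∫ x, divergence (dilationField r) x * D x ∂μ) atTop
      (𝓝 (Module.finrank ℝ E * ∫ x, D x ∂μ)) := by
  obtain ⟨C, hC⟩ := exists_abs_dilationDivergenceProfile_le (Module.finrank ℝ E)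
  simpa [divergence_dilationField, dilationDivergenceProfile,
    cutoffProfile_of_le_one zero_le_one] using
    tendsto_integral_comp_norm_sq_div_mul (continuous_dilationDivergenceProfile _) hC hD

variable {μ} in
theorem integrable_and_integral_eq_of_tendsto_integral_cutoff_mul [IsFiniteMeasureOnCompacts μ]
    {h : E → ℝ} (hcont : Continuous h) (hnonneg : ∀ x, 0 ≤ h x) {L : ℝ}
    (hlim : Tendsto (fun r : ℝ => ∫ x, cutoff r x * h x ∂μ) atTop (𝓝 L)) :
    Integrable h μ ∧ ∫ x, h x ∂μ = L := by
  have hcover : AECover μ atTop fun r : ℝ => Metric.closedBall (0 : E) r :=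
    aecover_closedBall tendsto_id
  have hball (r : ℝ) : IntegrableOn h (Metric.closedBall 0 r) μ :=
    hcont.continuousOn.integrableOn_compact (isCompact_closedBall 0 r)
  have hle : ∀ᶠ r in atTop, ∫ x in Metric.closedBall 0 r, h x ∂μ ≤ L + 1 := by
    filter_upwards [hlim.eventually_le_const (lt_add_one L), eventually_ne_atTop 0] with r hr hr0
    have hcut_int : Integrable (fun x => cutoff r x * h x) μ :=
      ((continuous_cutoff r).mul hcont).integrable_of_hasCompactSupport
        (hasCompactSupport_cutoff hr0).mul_right
    calc ∫ x in Metric.closedBall 0 r, h x ∂μ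
        = ∫ x in Metric.closedBall 0 r, cutoff r x * h x ∂μ :=
          setIntegral_congr_fun measurableSet_closedBall fun x hx => by
            simp [cutoff_eq_one_of_norm_le (mem_closedBall_zero_iff.1 hx)]
      _ ≤ ∫ x, cutoff r x * h x ∂μ := setIntegral_le_integral hcut_int
          (.of_forall fun x => mul_nonneg (cutoff_nonneg r x) (hnonneg x))
      _ ≤ L + 1 := hr
  have hint : Integrable h μ := hcover.integrable_of_integral_bounded_of_nonneg_ae (L + 1) hball
    (.of_forall hnonneg) hle
  exact ⟨hint, tendsto_nhds_unique (tendsto_integral_cutoff_mul hint) hlim⟩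

theorem integral_cutoff_mul_inner_gradient [μ.IsAddHaarMeasure] {K w : E → ℝ}
    (hK : ContDiff ℝ 1 K) (hw : ContDiff ℝ 1 w) {r : ℝ} (hr : r ≠ 0) :
    ∫ x, cutoff r x * (inner ℝ x (∇ K x) * w x) ∂μ
      = -(∫ x, K x * fderiv ℝ w x (dilationField r x) ∂μ)
        - ∫ x, divergence (dilationField r) x * (K x * w x) ∂μ := by
  have hV : ContDiff ℝ 1 (dilationField r : E → E) := contDiff_dilationField r
  have hVc := hasCompactSupport_dilationField (E := E) hr
  have hdiv (x : E) : w x * divergence (fun y => K y • dilationField r y) x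
      = cutoff r x * (inner ℝ x (∇ K x) * w x)
        + divergence (dilationField r) x * (K x * w x) := by
    rw [divergence_smul (hK.differentiable one_ne_zero x) (hV.differentiable one_ne_zero x),
      show fderiv ℝ K x (dilationField r x) = cutoff r x * inner ℝ x (∇ K x) by
        simp [dilationField, inner_gradient_right]]
    ring
  have hgradient_int : Integrable (fun x => cutoff r x * (inner ℝ x (∇ K x) * w x)) μ :=
    ((continuous_cutoff r).mul ((continuous_id.inner (contDiff_gradient hK
      (m := 0) (by simp)).continuous).mul hw.continuous)).integrable_of_hasCompactSupport
        (hasCompactSupport_cutoff hr).mul_right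
  have hdiv_int : Integrable (fun x => divergence (dilationField r) x * (K x * w x)) μ :=
    ((continuous_divergence hV).mul (hK.continuous.mul
      hw.continuous)).integrable_of_hasCompactSupport (hasCompactSupport_divergence hVc).mul_right
  have hKV : ContDiff ℝ 1 fun y => K y • dilationField r y := hK.smul hV
  have hparts := integral_mul_divergence μ hw hKV (.inr hVc.smul_left)
  rw [integral_congr_ae (.of_forall hdiv), integral_add hgradient_int hdiv_int] at hparts
  simp only [map_smul, smul_eq_mul] at hparts
  linarith

end InnerProductSpace

theorem fderiv_exp_two_mul {E : Type*} [NormedAddCommGroup E] [NormedSpace ℝ E] {u : E → ℝ} {x : E}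
    (hu : DifferentiableAt ℝ u x) (v : E) :
    fderiv ℝ (fun y => Real.exp (2 * u y)) x v = 2 * Real.exp (2 * u x) * fderiv ℝ u x v := by
  rw [((hu.hasFDerivAt.const_mul 2).exp).fderiv]
  simp only [smul_apply, smul_eq_mul]
  ring

theorem tendsto_integral_cutoff_mul_inner_gradient {u K : Plane → ℝ} (hu : ContDiff ℝ 2 u)
    (hK : ContDiff ℝ 1 K) (heq : ∀ x, -(Δ u x) = K x * Real.exp (2 * u x))
    (hcurv : Integrable fun x => K x * Real.exp (2 * u x))
    (hvol : Integrable fun x => Real.exp (2 * u x)) :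
    Tendsto (fun R : ℝ => ∫ x, cutoff R x * (inner ℝ x (∇ K x) * Real.exp (2 * u x))) atTop
      (𝓝 ((∫ x, K x * Real.exp (2 * u x)) * ((∫ x, K x * Real.exp (2 * u x)) - 4 * Real.pi)
        / (2 * Real.pi))) := by
  have hΔeq : Δ u = fun x => -(K x * Real.exp (2 * u x)) := funext fun x => by rw [← heq, neg_neg]
  have hΔ : Integrable (Δ u) := hΔeq ▸ hcurv.neg
  have hflux := (tendsto_integral_laplacian_mul_fderiv_dilationField hu hΔ hvol).const_mul 2
  have hlim := hflux.sub (tendsto_integral_divergence_dilationField_mul volume hcurv)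
  rw [finrank_euclideanSpace_fin] at hlim
  convert hlim.congr' ?_ using 2
  · rw [hΔeq, integral_neg]
    field_simp
    ring
  · filter_upwards [eventually_ne_atTop 0] with R hR
    rw [integral_cutoff_mul_inner_gradient volume hK
      (contDiff_const.mul (hu.of_le one_le_two)).exp hR, ← integral_neg, ← integral_const_mul]
    congr 2 with x
    rw [fderiv_exp_two_mul (hu.differentiable two_ne_zero x), hΔeq]
    ring

theorem continuous_inner_gradient_mul_exp {E : Type*} [NormedAddCommGroup E]
    [InnerProductSpace ℝ E] [CompleteSpace E] {u K : E → ℝ} (hu : Continuous u)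
    (hK : ContDiff ℝ 1 K) : Continuous fun x => inner ℝ x (∇ K x) * Real.exp (2 * u x) :=
  (continuous_id.inner (contDiff_gradient hK (m := 0) (by simp)).continuous).mul
    (continuous_const.mul hu).rexp

theorem pohozaev_identity {u K : Plane → ℝ} (hu : ContDiff ℝ 2 u) (hK : ContDiff ℝ 1 K)
    (heq : ∀ x, -(Δ u x) = K x * Real.exp (2 * u x))
    (hcurv : Integrable fun x => K x * Real.exp (2 * u x))
    (hvol : Integrable fun x => Real.exp (2 * u x)) (hgrad : ∀ x, 0 ≤ inner ℝ x (∇ K x)) :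
    Integrable (fun x => inner ℝ x (∇ K x) * Real.exp (2 * u x)) ∧
      ∫ x, inner ℝ x (∇ K x) * Real.exp (2 * u x)
        = (∫ x, K x * Real.exp (2 * u x)) * ((∫ x, K x * Real.exp (2 * u x)) - 4 * Real.pi)
          / (2 * Real.pi) :=
  integrable_and_integral_eq_of_tendsto_integral_cutoff_mul
    (continuous_inner_gradient_mul_exp hu.continuous hK)
    (fun x => mul_nonneg (hgrad x) (Real.exp_pos _).le)
    (tendsto_integral_cutoff_mul_inner_gradient hu hK heq hcurv hvol)

theorem forall_inner_gradient_eq_zero_iff {E : Type*} [NormedAddCommGroup E]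
    [InnerProductSpace ℝ E] [CompleteSpace E] {K : E → ℝ} (hK : ContDiff ℝ 1 K) :
    (∀ x, inner ℝ x (∇ K x) = 0) ↔ ∀ x, K x = K 0 := by
  refine ⟨fun h x => ?_, fun h x => ?_⟩
  · have hderiv (t : ℝ) : HasDerivAt (fun t : ℝ => K (t • x)) (fderiv ℝ K (t • x) x) t :=
      (hK.differentiable one_ne_zero (t • x)).hasFDerivAt.comp_hasDerivAt t
        (by simpa using (hasDerivAt_id t).smul_const x)
    have hcont : Continuous fun t : ℝ => fderiv ℝ K (t • x) x :=
      ((hK.continuous_fderiv one_ne_zero).comp (by fun_prop)).clm_apply continuous_const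
    have hzero : (fun t : ℝ => fderiv ℝ K (t • x) x) = fun _ => 0 := by
      refine hcont.ext_on (dense_compl_singleton (0 : ℝ)) continuous_const fun t ht => ?_
      have hradial := h (t • x)
      rw [inner_gradient_right, map_smul, smul_eq_mul] at hradial
      exact (mul_eq_zero.1 hradial).resolve_left ht
    simpa using is_const_of_deriv_eq_zero (fun t => (hderiv t).differentiableAt)
      (fun t => (hderiv t).deriv.trans (congrFun hzero t)) 1 0
  · rw [inner_gradient_right, funext h, fderiv_const_apply, zero_apply, map_zero]

theorem integral_curvature_pos {u K : Plane → ℝ} (hu : ContDiff ℝ 2 u)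
    (heq : ∀ x, -(Δ u x) = K x * Real.exp (2 * u x))
    (hcurv : Integrable fun x => K x * Real.exp (2 * u x))
    (hvol : Integrable fun x => Real.exp (2 * u x)) : 0 < ∫ x, K x * Real.exp (2 * u x) := by
  have hΔeq : Δ u = fun x => -(K x * Real.exp (2 * u x)) := funext fun x => by rw [← heq, neg_neg]
  have hneg := integral_laplacian_neg hu (hΔeq ▸ hcurv.neg) hvol
  rw [hΔeq, integral_neg] at hneg
  exact neg_lt_zero.1 hneg

theorem integral_curvature_eq_iff {u K : Plane → ℝ} (hu : ContDiff ℝ 2 u)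
    (hK : ContDiff ℝ 1 K) (heq : ∀ x, -(Δ u x) = K x * Real.exp (2 * u x))
    (hcurv : Integrable fun x => K x * Real.exp (2 * u x))
    (hvol : Integrable fun x => Real.exp (2 * u x)) (hgrad : ∀ x, 0 ≤ inner ℝ x (∇ K x)) :
    (∫ x, K x * Real.exp (2 * u x)) = 4 * Real.pi ↔ ∀ x, inner ℝ x (∇ K x) = 0 := by
  have hpos := integral_curvature_pos hu heq hcurv hvol
  obtain ⟨hint, hpohozaev⟩ := pohozaev_identity hu hK heq hcurv hvol hgrad
  have hzero : (∫ x, inner ℝ x (∇ K x) * Real.exp (2 * u x)) = 0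
      ↔ ∀ x, inner ℝ x (∇ K x) = 0 := by
    rw [integral_eq_zero_iff_of_nonneg (fun x => mul_nonneg (hgrad x) (Real.exp_pos _).le) hint,
      (continuous_inner_gradient_mul_exp hu.continuous hK).ae_eq_iff_eq _ continuous_zero,
      funext_iff]
    simp
  rw [← hzero, hpohozaev]
  simp [hpos.ne', Real.pi_ne_zero, sub_eq_zero]

theorem mainTheorem9_general {u K : Plane → ℝ} (hu : ContDiff ℝ 2 u) (hK : ContDiff ℝ 1 K)
    (heq : ∀ x, -(Δ u x) = K x * Real.exp (2 * u x))
    (hcurv : Integrable fun x => K x * Real.exp (2 * u x))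
    (hvol : Integrable fun x => Real.exp (2 * u x)) (hgrad : ∀ x, 0 ≤ inner ℝ x (∇ K x)) :
    4 * Real.pi ≤ ∫ x, K x * Real.exp (2 * u x) ∧
      ((∫ x, K x * Real.exp (2 * u x)) = 4 * Real.pi ↔ ∃ c : ℝ, 0 < c ∧ ∀ x, K x = c) := by
  have hpos := integral_curvature_pos hu heq hcurv hvol
  refine ⟨?_, ?_⟩
  · have hnonneg : 0 ≤ ∫ x, inner ℝ x (∇ K x) * Real.exp (2 * u x) :=
      integral_nonneg fun x => mul_nonneg (hgrad x) (Real.exp_pos _).le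
    rw [(pohozaev_identity hu hK heq hcurv hvol hgrad).2,
      le_div_iff₀ (by positivity), zero_mul] at hnonneg
    exact sub_nonneg.1 (nonneg_of_mul_nonneg_right hnonneg hpos)
  · rw [integral_curvature_eq_iff hu hK heq hcurv hvol hgrad, forall_inner_gradient_eq_zero_iff hK]
    refine ⟨fun hconst => ⟨K 0, ?_, hconst⟩, fun ⟨c, _, hc⟩ x => (hc x).trans (hc 0).symm⟩
    simp only [hconst, integral_const_mul] at hpos
    exact pos_of_mul_pos_left hpos (integral_nonneg fun x => (Real.exp_pos _).le)

end Pohozaev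

theorem mainTheorem9
    (u K : EuclideanSpace ℝ (Fin 2) → ℝ)
    (hu : ContDiff ℝ ∞ u) (hK : ContDiff ℝ ∞ K)
    (heq : ∀ x, -(Δ u x) = K x * Real.exp (2 * u x))
    (hcurv : Integrable (fun x => K x * Real.exp (2 * u x)) volume)
    (hvol : Integrable (fun x => Real.exp (2 * u x)) volume)
    (hgrad : ∀ x, 0 ≤ inner ℝ x (∇ K x))
    (hinf : ∃ R : ℝ, ∀ x, R ≤ ‖x‖ → 0 ≤ K x) :
    4 * Real.pi ≤ ∫ x, K x * Real.exp (2 * u x) ∧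
      ((∫ x, K x * Real.exp (2 * u x)) = 4 * Real.pi ↔ ∃ c : ℝ, 0 < c ∧ ∀ x, K x = c) :=
  mainTheorem9_general (contDiff_infty.1 hu 2) (contDiff_infty.1 hK 1) heq hcurv hvol hgrad
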